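/- A real is a subset of $\mathbb N$. A real $C$ is generically computable (respectively generically $B$-computable, for a real $B$) if there is a partial recursive (respectively partial $B$-recursive) $\{0,1\}$-valued function $\varphi$ whose domain $D$ has density 1, i.e. $|D\cap\{0,\dots,n-1\}|/n\to 1$, and such that for all $n$: if $\varphi(n)=1$ then $n\in C$, and if $\varphi(n)=0$ then $n\notin C$. Reals $A$ and $B$ form a minimal pair for generic computability if both are nonrecursive and every real that is both generically $A$-computable and generically $B$-computable is generically computable. A 4-ary tree is a set $T$ of finite strings over $\{0,1,2,3\}$ that is closed under initial segments; strings are identified with natural numbers through a standard coding, and $T'$ denotes the Turing jump of $T$. A real (or a path) $X$ is low if $X'\le_T\emptyset'$. Let $\mathcal F$ be a function that assigns to each infinite 4-ary tree $T$ an infinite path $\mathcal F(T)$ through $T$, uniformly recursively in $T'$, i.e. there is one Turing functional $\Phi$ with $\Phi^{T'}=\mathcal F(T)$ for every infinite 4-ary tree $T$. Then for any reals $A$ and $B$, at least one of the following holds: 1. $A$ and $B$ do not form a minimal pair for generic computability; 2. there is an infinite recursive 4-ary tree $T$ with $\mathcal F(T)\ge_T A$; 3. there is an infinite recursive 4-ary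 tree $T$ with $\mathcal F(T)\ge_T B$. Moreover, there is such a function $\mathcal F$ for which $\mathcal F(T)$ is low for every infinite recursive 4-ary tree $T$; consequently, if $A$ and $B$ form a minimal pair for generic computability, then $A$ is low or $B$ is low. -/

import Mathlib

open scoped Computability

namespace GenericPairs

/-- A set of natural numbers has density 1 if `|A ∩ {0, …, n - 1}| / n → 1`. -/
def HasDensityOne (A : Set ℕ) : Prop :=
  Filter.Tendsto (fun n : ℕ => ((A ∩ Set.Iio n).ncard : ℝ) / (n : ℝ)) Filter.atTop (nhds 1)

open Classical in
/-- The characteristic function of a set of natural numbers. -/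
noncomputable def chi (A : Set ℕ) : ℕ → ℕ := fun n => if n ∈ A then 1 else 0

/-- `φ` is a generic computation of `A`: it is a partial `{0,1}`-valued function (`true` is 1,
`false` is 0) with domain of density 1 that never gives a wrong answer about `A`. -/
def IsGenericDescription (φ : ℕ →. Bool) (A : Set ℕ) : Prop :=
  HasDensityOne φ.Dom ∧ ∀ n, (true ∈ φ n → n ∈ A) ∧ (false ∈ φ n → n ∉ A)

/-- `A` is generically computable. -/
def GenericallyComputable (A : Set ℕ) : Prop :=
  ∃ φ : ℕ →. Bool, Partrec φ ∧ IsGenericDescription φ A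

/-- `A` is generically `B`-computable. -/
def GenericallyComputableIn (B A : Set ℕ) : Prop :=
  ∃ φ : ℕ →. Bool, RecursiveIn {(chi B : ℕ →. ℕ)} φ ∧ IsGenericDescription φ A

/-- `A` and `B` form a minimal pair for generic computability: both are nonrecursive, and every
set that is generically computable from each of them is generically computable. -/
def IsMinimalPair (A B : Set ℕ) : Prop :=
  ¬ ComputablePred (fun n => n ∈ A) ∧ ¬ ComputablePred (fun n => n ∈ B) ∧
    ∀ C : Set ℕ, GenericallyComputableIn A C → GenericallyComputableIn B C →
      GenericallyComputable C

/-- Programs for oracle computations, i.e. indices of Turing functionals: one constructor for each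
clause of `Nat.RecursiveIn`. -/
inductive OracleCode : Type
  | zero : OracleCode
  | succ : OracleCode
  | left : OracleCode
  | right : OracleCode
  | oracle : OracleCode
  | pair : OracleCode → OracleCode → OracleCode
  | comp : OracleCode → OracleCode → OracleCode
  | prec : OracleCode → OracleCode → OracleCode
  | rfind : OracleCode → OracleCode

namespace OracleCode

/-- The partial function that a program computes with oracle `g`. -/
def eval (g : ℕ → ℕ) : OracleCode → ℕ →. ℕ
  | zero => fun _ => Part.some 0
  | succ => fun n => Part.some (n + 1)
  | left => fun n => Part.some n.unpair.1
  | right => fun n => Part.some n.unpair.2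
  | oracle => fun n => Part.some (g n)
  | pair c d => fun n => Nat.pair <$> eval g c n <*> eval g d n
  | comp c d => fun n => eval g d n >>= eval g c
  | prec c d => fun p =>
      let (a, n) := Nat.unpair p
      n.rec (eval g c a) fun y IH => do
        let i ← IH
        eval g d (Nat.pair a (Nat.pair y i))
  | rfind c => fun a => Nat.rfind fun n => (fun m => m = 0) <$> eval g c (Nat.pair a n)

/-- The standard effective bijective numbering of programs. -/
def index : OracleCode → ℕ
  | zero => 0
  | succ => 1
  | left => 2
  | right => 3
  | oracle => 4
  | pair c d => 4 * Nat.pair (index c) (index d) + 5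
  | comp c d => 4 * Nat.pair (index c) (index d) + 6
  | prec c d => 4 * Nat.pair (index c) (index d) + 7
  | rfind c => 4 * index c + 8

/-- The programs compute exactly the functions that are recursive in the oracle. -/
theorem exists_eval_iff (g : ℕ → ℕ) (f : ℕ →. ℕ) :
    (∃ c : OracleCode, eval g c = f) ↔ Nat.RecursiveIn {(g : ℕ →. ℕ)} f := by
  constructor
  · rintro ⟨c, rfl⟩
    induction c with
    | zero => exact .zero
    | succ => exact .succ
    | left => exact .left
    | right => exact .right
    | oracle => exact .oracle _ rfl
    | pair c d hc hd => exact .pair hc hd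
    | comp c d hc hd => exact .comp hc hd
    | prec c d hc hd => exact .prec hc hd
    | rfind c hc => exact .rfind hc
  · intro h
    induction h with
    | zero => exact ⟨zero, rfl⟩
    | succ => exact ⟨succ, rfl⟩
    | left => exact ⟨left, rfl⟩
    | right => exact ⟨right, rfl⟩
    | oracle k hk => exact ⟨oracle, hk.symm⟩
    | pair _ _ h₁ h₂ =>
      obtain ⟨c, rfl⟩ := h₁
      obtain ⟨d, rfl⟩ := h₂
      exact ⟨pair c d, rfl⟩
    | comp _ _ h₁ h₂ =>
      obtain ⟨c, rfl⟩ := h₁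
      obtain ⟨d, rfl⟩ := h₂
      exact ⟨comp c d, rfl⟩
    | prec _ _ h₁ h₂ =>
      obtain ⟨c, rfl⟩ := h₁
      obtain ⟨d, rfl⟩ := h₂
      exact ⟨prec c d, rfl⟩
    | rfind _ h₁ =>
      obtain ⟨c, rfl⟩ := h₁
      exact ⟨rfind c, rfl⟩

end OracleCode

/-- The Turing jump `g' = {e | Φ_e^g(e) halts}`. -/
def jump (g : ℕ → ℕ) : Set ℕ :=
  {e | ∃ c : OracleCode, c.index = e ∧ (c.eval g e).Dom}

/-- `g` is low: its jump is recursive in the jump of the empty set. -/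
def IsLow (g : ℕ → ℕ) : Prop :=
  (chi (jump g) : ℕ →. ℕ) ≤ᵀ (chi (jump (chi ∅)) : ℕ →. ℕ)

/-- A 4-ary branching tree: a set of finite strings over `{0,1,2,3}` closed under initial
segments. -/
def IsTree (T : Set (List (Fin 4))) : Prop :=
  ∀ σ τ : List (Fin 4), τ <+: σ → σ ∈ T → τ ∈ T

/-- An infinite path through `T`. -/
def IsPath (f : ℕ → Fin 4) (T : Set (List (Fin 4))) : Prop :=
  ∀ n : ℕ, (List.range n).map f ∈ T

/-- A tree as an oracle, through the standard coding of strings by numbers. -/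
noncomputable def treeOracle (T : Set (List (Fin 4))) : ℕ → ℕ := chi (Encodable.encode '' T)

/-- A path as a function on the natural numbers. -/
def pathFun (f : ℕ → Fin 4) : ℕ → ℕ := fun n => (f n : ℕ)

/-- `F` picks an infinite path `F(T)` through each infinite 4-ary tree `T`, uniformly recursively
in `T'`: a single Turing functional computes `F(T)` from `T'` for all such `T`. -/
def IsUniformPathChoice (F : Set (List (Fin 4)) → ℕ → Fin 4) : Prop :=
  (∀ T, IsTree T → T.Infinite → IsPath (F T) T) ∧
    ∃ c : OracleCode, ∀ T, IsTree T → T.Infinite →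
      c.eval (chi (jump (treeOracle T))) = (pathFun (F T) : ℕ →. ℕ)

/-- `T` is an infinite recursive 4-ary tree. -/
def IsInfiniteRecursiveTree (T : Set (List (Fin 4))) : Prop :=
  IsTree T ∧ T.Infinite ∧ ComputablePred (fun σ => σ ∈ T)

end GenericPairs

/-!
Three facts are proved: every uniform choice of paths yields a dichotomy for minimal pairs, there is
a uniform choice of low paths, and hence one half of a minimal pair is low.

**Computability.** A program with an oracle is translated into an ordinary program that takes a
finite initial segment of the oracle as an additional argument (`toCode`), so that the step-bounded
evaluation `evalAt` is primitive recursive. Everything about oracles goes through it: the use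
principle `mem_eval_iff_exists_restrict`, the limit lemma `eventually_evalAt`, the closure of
recursive functionals under search `UniformlyRecursive.search`, and the fact that the jump decides
existential properties of its oracle uniformly, `exists_mem_jump_iff_of_primrecRel`.

**Low paths.** `lowPath` is the low basis construction: step `e` keeps program `e` from halting
if the subtree on which it does not halt is infinite, and then takes the least digit above which the
remaining tree is infinite. The questions asked are answered by the jump of the tree, uniformly in
the tree, and the answers also decide the jump of the path.

**The dichotomy.** Let `c` compute `F(T)` from `T'`, and suppose that no `F(T)` with `T` infinite
and recursive computes `A` or `B`. A string over `{0, 1, 2, 3}` is read as a pair of binary strings,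
so that `(A, B)` is a possible path. Column `e` of the natural numbers serves to diagonalize against
the generic description with program `e`. It is divided into finite blocks, and it comes with a
recursive tree `columnTree c e` and stagewise approximations `stagePath c e s` to the path through
this tree that `c` chooses; the tree is defined by recursion along the stages, since the
approximation at stage `s` uses only a finite part of it. Each block `n` has a level, the number
of digits that are compared. The set `diagonalSet c A B` contains a single element of the block,
the first on which program `e` gives an answer, provided that this answer is negative and that until
then, beginning with stage `n`, all approximations agree with both `A` and `B` up to the
level of the block. The tree consists of the pairs for which such an agreement never occurs.

* With oracle `A` one answers negatively on a whole block as soon as `A` disagrees with an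
  approximation, and on all but one element of the block if program `e` halts first. Levels are
  assigned greedily so that the blocks on which program `e` never halts have different levels
  (`injOn_level`). If infinitely many of these blocks were left undecided, then `A` would be the
  limit of the approximations, hence recursive in `F(T)` or, if the tree is finite, recursive
  (`finite_agreesUntil`). So `diagonalSet c A B` is generically computable from `A`, and
  likewise from `B`.
* If program `e` described `diagonalSet c A B` generically, it would halt on almost all blocks, and
  some level `k` would recur infinitely often (`exists_infinite_level`). No agreement with
  `(A, B)` would ever occur, so `(A, B)` would be a path and the tree infinite. The approximations
  converge to the path `F(T)`, so on a late block of level `k` they all agree with `F(T)` up to `k`,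
  which contradicts that `F(T)` is a path through the tree
  (`not_genericallyComputable_diagonalSet`).
-/

namespace GenericPairs

open Nat.Partrec (Code)
open Encodable OracleCode

/-! ### Oracle computations with finite oracles -/

/-- The finite initial segment of length `t` of an oracle. -/
def restrict (g : ℕ → ℕ) (t : ℕ) : List ℕ := (List.range t).map g

@[simp] theorem length_restrict (g : ℕ → ℕ) (t : ℕ) : (restrict g t).length = t := by
  simp [restrict]

theorem getElem?_restrict {g : ℕ → ℕ} {t n : ℕ} (h : n < t) : (restrict g t)[n]? = some (g n) := by
  simp [restrict, h]

theorem take_restrict (g : ℕ → ℕ) {s t : ℕ} (h : t ≤ s) :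
    (restrict g s).take t = restrict g t := by
  simp [restrict, ← List.map_take, List.take_range, Nat.min_eq_left h]

namespace OracleCode

/-- The program with a given index. -/
def ofIndex : ℕ → OracleCode
  | 0 => zero
  | 1 => succ
  | 2 => left
  | 3 => right
  | 4 => oracle
  | n + 5 =>
    have h1 : (n / 4).unpair.1 < n + 5 :=
      lt_of_le_of_lt (Nat.unpair_left_le _) (by omega)
    have h2 : (n / 4).unpair.2 < n + 5 :=
      lt_of_le_of_lt (Nat.unpair_right_le _) (by omega)
    if n % 4 = 0 then pair (ofIndex (n / 4).unpair.1) (ofIndex (n / 4).unpair.2)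
    else if n % 4 = 1 then comp (ofIndex (n / 4).unpair.1) (ofIndex (n / 4).unpair.2)
    else if n % 4 = 2 then prec (ofIndex (n / 4).unpair.1) (ofIndex (n / 4).unpair.2)
    else rfind (ofIndex (n / 4))

theorem ofIndex_index (c : OracleCode) : ofIndex c.index = c := by
  induction c with
  | zero | succ | left | right | oracle => simp [index, ofIndex]
  | pair c d hc hd =>
    rw [index, ofIndex, if_pos (by omega), show 4 * Nat.pair c.index d.index / 4 =
      Nat.pair c.index d.index by omega, Nat.unpair_pair, hc, hd]
  | comp c d hc hd =>
    rw [index, show 4 * Nat.pair c.index d.index + 6 = (4 * Nat.pair c.index d.index + 1) + 5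
      by omega, ofIndex, if_neg (by omega), if_pos (by omega),
      show (4 * Nat.pair c.index d.index + 1) / 4 = Nat.pair c.index d.index by omega,
      Nat.unpair_pair, hc, hd]
  | prec c d hc hd =>
    rw [index, show 4 * Nat.pair c.index d.index + 7 = (4 * Nat.pair c.index d.index + 2) + 5
      by omega, ofIndex, if_neg (by omega), if_neg (by omega), if_pos (by omega),
      show (4 * Nat.pair c.index d.index + 2) / 4 = Nat.pair c.index d.index by omega,
      Nat.unpair_pair, hc, hd]
  | rfind c hc =>
    rw [index, show 4 * c.index + 8 = (4 * c.index + 3) + 5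
      by omega, ofIndex, if_neg (by omega), if_neg (by omega), if_neg (by omega),
      show (4 * c.index + 3) / 4 = c.index by omega, hc]

theorem index_ofIndex (n : ℕ) : (ofIndex n).index = n := by
  induction n using Nat.strong_induction_on with
  | _ n ih =>
    match n with
    | 0 | 1 | 2 | 3 | 4 => simp [index, ofIndex]
    | n + 5 =>
      have h1 : (n / 4).unpair.1 < n + 5 :=
        lt_of_le_of_lt (Nat.unpair_left_le _) (by omega)
      have h2 : (n / 4).unpair.2 < n + 5 :=
        lt_of_le_of_lt (Nat.unpair_right_le _) (by omega)
      have h3 : n / 4 < n + 5 := by omega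
      rw [ofIndex]
      split_ifs <;> simp only [index, ih _ h1, ih _ h2, ih _ h3, Nat.pair_unpair] <;> omega

/-- The partial function that a program computes with a partial oracle; a computation that asks
for an undefined value of the oracle diverges. -/
def evalPart (o : ℕ →. ℕ) : OracleCode → ℕ →. ℕ
  | zero => fun _ => Part.some 0
  | succ => fun n => Part.some (n + 1)
  | left => fun n => Part.some n.unpair.1
  | right => fun n => Part.some n.unpair.2
  | oracle => o
  | pair c d => fun n => Nat.pair <$> evalPart o c n <*> evalPart o d n
  | comp c d => fun n => evalPart o d n >>= evalPart o c
  | prec c d => Nat.unpaired fun a n =>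
      n.rec (evalPart o c a) fun y IH => do
        let i ← IH
        evalPart o d (Nat.pair a (Nat.pair y i))
  | rfind c => fun a => Nat.rfind fun n => (fun m => m = 0) <$> evalPart o c (Nat.pair a n)

theorem evalPart_coe (g : ℕ → ℕ) (c : OracleCode) : evalPart (g : ℕ →. ℕ) c = eval g c := by
  induction c with
  | zero | succ | left | right | oracle => rfl
  | pair c d hc hd => simp only [evalPart, eval, hc, hd]; rfl
  | comp c d hc hd => simp only [evalPart, eval, hc, hd]; rfl
  | prec c d hc hd => simp only [evalPart, eval, hc, hd]; rfl
  | rfind c hc => simp only [evalPart, eval, hc]; rfl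

theorem mem_evalPart_pair {o : ℕ →. ℕ} {c d : OracleCode} {n v : ℕ} :
    v ∈ evalPart o (pair c d) n ↔
      ∃ a ∈ evalPart o c n, ∃ b ∈ evalPart o d n, v = Nat.pair a b := by
  change v ∈ Nat.pair <$> evalPart o c n <*> evalPart o d n ↔ _
  simp [Seq.seq, eq_comm]

theorem mem_evalPart_comp {o : ℕ →. ℕ} {c d : OracleCode} {n v : ℕ} :
    v ∈ evalPart o (comp c d) n ↔ ∃ a ∈ evalPart o d n, v ∈ evalPart o c a :=
  Part.mem_bind_iff

theorem evalPart_prec_zero {o : ℕ →. ℕ} {c d : OracleCode} {a : ℕ} :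
    evalPart o (prec c d) (Nat.pair a 0) = evalPart o c a := by
  simp [evalPart]

theorem mem_evalPart_prec_succ {o : ℕ →. ℕ} {c d : OracleCode} {a n v : ℕ} :
    v ∈ evalPart o (prec c d) (Nat.pair a (n + 1)) ↔
      ∃ i ∈ evalPart o (prec c d) (Nat.pair a n), v ∈ evalPart o d (Nat.pair a (Nat.pair n i)) := by
  simp [evalPart]

theorem mem_rfind_eq_zero {f : ℕ → Part ℕ} {v : ℕ} :
    v ∈ Nat.rfind (fun m => (fun m => decide (m = 0)) <$> f m) ↔
      0 ∈ f v ∧ ∀ m < v, ∃ w ∈ f m, w ≠ 0 := by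
  refine Nat.mem_rfind.trans (and_congr ?_ ⟨fun h m hm => ?_, fun h m hm => ?_⟩)
  · simp
  · simpa using h hm
  · simpa using h m hm

theorem mem_evalPart_rfind {o : ℕ →. ℕ} {c : OracleCode} {n v : ℕ} :
    v ∈ evalPart o (rfind c) n ↔ 0 ∈ evalPart o c (Nat.pair n v) ∧
      ∀ m < v, ∃ w ∈ evalPart o c (Nat.pair n m), w ≠ 0 :=
  mem_rfind_eq_zero (f := fun m => evalPart o c (Nat.pair n m))

theorem evalPart_mono {o o' : ℕ →. ℕ} (h : ∀ n, ∀ v ∈ o n, v ∈ o' n) (c : OracleCode) :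
    ∀ n, ∀ v ∈ evalPart o c n, v ∈ evalPart o' c n := by
  induction c with
  | zero | succ | left | right => exact fun n v hv => hv
  | oracle => exact h
  | pair c d hc hd =>
    intro n v hv
    obtain ⟨a, ha, b, hb, rfl⟩ := mem_evalPart_pair.1 hv
    exact mem_evalPart_pair.2 ⟨a, hc _ _ ha, b, hd _ _ hb, rfl⟩
  | comp c d hc hd =>
    intro n v hv
    obtain ⟨w, hw, hv⟩ := mem_evalPart_comp.1 hv
    exact mem_evalPart_comp.2 ⟨w, hd _ _ hw, hc _ _ hv⟩
  | prec c d hc hd =>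
    intro p
    rw [← Nat.pair_unpair p]
    generalize p.unpair.2 = n
    induction n with
    | zero => simpa only [evalPart_prec_zero] using hc _
    | succ n ih =>
      intro v hv
      obtain ⟨w, hw, hv⟩ := mem_evalPart_prec_succ.1 hv
      exact mem_evalPart_prec_succ.2 ⟨w, ih _ hw, hd _ _ hv⟩
  | rfind c hc =>
    intro n v hv
    obtain ⟨h0, hlt⟩ := mem_evalPart_rfind.1 hv
    refine mem_evalPart_rfind.2 ⟨hc _ _ h0, fun m hm => ?_⟩
    obtain ⟨w, hw, hne⟩ := hlt m hm
    exact ⟨w, hc _ _ hw, hne⟩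

/-- A finite list as a partial oracle, undefined beyond its length. -/
def listOracle (L : List ℕ) : ℕ →. ℕ := fun n => (L[n]? : Part ℕ)

theorem mem_listOracle_restrict {g : ℕ → ℕ} {t n v : ℕ} :
    v ∈ listOracle (restrict g t) n ↔ n < t ∧ v = g n := by
  by_cases h : n < t
  · rw [listOracle, getElem?_restrict h]
    simp [h]
  · simp [listOracle, restrict, h]

theorem evalPart_restrict_mono (g : ℕ → ℕ) (c : OracleCode) {s t : ℕ} (h : s ≤ t) {n v : ℕ}
    (hv : v ∈ evalPart (listOracle (restrict g s)) c n) :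
    v ∈ evalPart (listOracle (restrict g t)) c n := by
  refine evalPart_mono (fun m w hw => ?_) c n v hv
  rw [mem_listOracle_restrict] at hw ⊢
  exact ⟨hw.1.trans_le h, hw.2⟩

/-- A halting computation asks only finitely many oracle questions. -/
theorem exists_evalPart_restrict (g : ℕ → ℕ) (c : OracleCode) :
    ∀ n, ∀ v ∈ eval g c n, ∃ t, v ∈ evalPart (listOracle (restrict g t)) c n := by
  simp only [← evalPart_coe]
  induction c with
  | zero | succ | left | right => exact fun n v hv => ⟨0, hv⟩
  | oracle =>
    intro n v hv
    exact ⟨n + 1, mem_listOracle_restrict.2 ⟨n.lt_succ_self, by simpa [evalPart] using hv⟩⟩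
  | pair c d hc hd =>
    intro n v hv
    obtain ⟨a, ha, b, hb, rfl⟩ := mem_evalPart_pair.1 hv
    obtain ⟨t, ht⟩ := hc _ _ ha
    obtain ⟨u, hu⟩ := hd _ _ hb
    exact ⟨max t u, mem_evalPart_pair.2 ⟨a, evalPart_restrict_mono g c (le_max_left _ _) ht, b,
      evalPart_restrict_mono g d (le_max_right _ _) hu, rfl⟩⟩
  | comp c d hc hd =>
    intro n v hv
    obtain ⟨w, hw, hv⟩ := mem_evalPart_comp.1 hv
    obtain ⟨t, ht⟩ := hc _ _ hv
    obtain ⟨u, hu⟩ := hd _ _ hw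
    exact ⟨max t u, mem_evalPart_comp.2 ⟨w, evalPart_restrict_mono g d (le_max_right _ _) hu,
      evalPart_restrict_mono g c (le_max_left _ _) ht⟩⟩
  | prec c d hc hd =>
    intro p
    rw [← Nat.pair_unpair p]
    generalize p.unpair.2 = n
    induction n with
    | zero => simpa only [evalPart_prec_zero] using hc _
    | succ n ih =>
      intro v hv
      obtain ⟨w, hw, hv⟩ := mem_evalPart_prec_succ.1 hv
      obtain ⟨t, ht⟩ := ih _ hw
      obtain ⟨u, hu⟩ := hd _ _ hv
      exact ⟨max t u, mem_evalPart_prec_succ.2 ⟨w,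
        evalPart_restrict_mono g (prec c d) (le_max_left _ _) ht,
        evalPart_restrict_mono g d (le_max_right _ _) hu⟩⟩
  | rfind c hc =>
    intro n v hv
    obtain ⟨h0, hlt⟩ := mem_evalPart_rfind.1 hv
    obtain ⟨t, ht⟩ := hc _ _ h0
    have key : ∀ k ≤ v, ∃ u, ∀ m < k,
        ∃ w ∈ evalPart (listOracle (restrict g u)) c (Nat.pair n m), w ≠ 0 := by
      intro k
      induction k with
      | zero => exact fun _ => ⟨0, fun m hm => absurd hm (Nat.not_lt_zero m)⟩
      | succ k ih =>
        intro hk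
        obtain ⟨u, hu⟩ := ih (by omega)
        obtain ⟨w, hw, hne⟩ := hlt k (by omega)
        obtain ⟨u', hu'⟩ := hc _ _ hw
        refine ⟨max u u', fun m hm => ?_⟩
        rcases Nat.lt_succ_iff_lt_or_eq.1 hm with hm | rfl
        · obtain ⟨w, hw, hne⟩ := hu m hm
          exact ⟨w, evalPart_restrict_mono g c (le_max_left _ _) hw, hne⟩
        · exact ⟨w, evalPart_restrict_mono g c (le_max_right _ _) hu', hne⟩
    obtain ⟨u, hu⟩ := key v le_rfl
    refine ⟨max t u, mem_evalPart_rfind.2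
      ⟨evalPart_restrict_mono g c (le_max_left _ _) ht, fun m hm => ?_⟩⟩
    obtain ⟨w, hw, hne⟩ := hu m hm
    exact ⟨w, evalPart_restrict_mono g c (le_max_right _ _) hw, hne⟩

/-- The use principle. -/
theorem mem_eval_iff_exists_restrict {g : ℕ → ℕ} {c : OracleCode} {n v : ℕ} :
    v ∈ eval g c n ↔ ∃ t, v ∈ evalPart (listOracle (restrict g t)) c n := by
  refine ⟨exists_evalPart_restrict g c n v, fun ⟨t, ht⟩ => ?_⟩
  rw [← evalPart_coe]
  refine evalPart_mono (fun m w hw => ?_) c n v ht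
  simpa using (mem_listOracle_restrict.1 hw).2

/-- The program, for the oracle-free machine, that looks up an entry of a coded list. -/
theorem exists_lookupCode : ∃ c : Code, ∀ (L : List ℕ) (n : ℕ),
    Code.eval c (Nat.pair (encode L) n) = listOracle L n := by
  have : Partrec (fun p : ℕ => ((((decode p.unpair.1 : Option (List ℕ)).getD [])[p.unpair.2]? :
      Option ℕ) : Part ℕ)) :=
    Computable.ofOption (Primrec.to_comp (Primrec.list_getElem?.comp
      (Primrec.option_getD.comp (Primrec.decode.comp (Primrec.fst.comp Primrec.unpair))
        (Primrec.const [])) (Primrec.snd.comp Primrec.unpair)))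
  obtain ⟨c, hc⟩ := Code.exists_code.1 (Partrec.nat_iff.1 this)
  exact ⟨c, fun L n => by simp [hc, listOracle]⟩

/-- A fixed program that looks up an entry of a coded list. -/
noncomputable def lookupCode : Code := exists_lookupCode.choose

theorem eval_lookupCode (L : List ℕ) (n : ℕ) :
    Code.eval lookupCode (Nat.pair (encode L) n) = listOracle L n :=
  exists_lookupCode.choose_spec L n

/-- A program with a finite oracle becomes an ordinary program that takes the coded oracle as an
additional first argument. -/
noncomputable def toCode : OracleCode → Code
  | zero => .zero
  | succ => .comp .succ .right
  | left => .comp .left .right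
  | right => .comp .right .right
  | oracle => lookupCode
  | pair c d => .pair (toCode c) (toCode d)
  | comp c d => .comp (toCode c) (.pair .left (toCode d))
  | prec c d =>
      .comp (.prec (toCode c) (.comp (toCode d)
          (.pair (.comp .left .left) (.pair (.comp .right .left) .right))))
        (.pair (.pair .left (.comp .left .right)) (.comp .right .right))
  | rfind c =>
      .comp (.rfind' (.comp (toCode c)
          (.pair (.comp .left .left) (.pair (.comp .right .left) .right))))
        (.pair .id .zero)

theorem eval_code_comp (c d : Code) (n : ℕ) :
    Code.eval (.comp c d) n = (Code.eval d n).bind fun a => Code.eval c a := rfl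

theorem eval_code_pair (c d : Code) (n : ℕ) :
    Code.eval (.pair c d) n =
      (Code.eval c n).bind fun a => (Code.eval d n).map (Nat.pair a) := by
  simp [Code.eval, Seq.seq, Part.bind_map]

theorem eval_code_basic (n : ℕ) : Code.eval .zero n = Part.some 0 ∧
    Code.eval .succ n = Part.some (n + 1) ∧ Code.eval .left n = Part.some n.unpair.1 ∧
    Code.eval .right n = Part.some n.unpair.2 :=
  ⟨rfl, rfl, rfl, rfl⟩

theorem eval_code_rfind' (c : Code) (a : ℕ) :
    Code.eval (.rfind' c) (Nat.pair a 0) =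
      Nat.rfind fun n => (fun m => decide (m = 0)) <$> Code.eval c (Nat.pair a n) := by
  simp only [Code.eval, Nat.unpaired, Nat.unpair_pair, Nat.add_zero, Part.map_eq_map]
  exact Part.map_id' (fun _ => rfl) _

/-- The translated program simulates the given one on every finite oracle. -/
theorem eval_toCode (L : List ℕ) (c : OracleCode) (n : ℕ) :
    Code.eval (toCode c) (Nat.pair (encode L) n) = evalPart (listOracle L) c n := by
  have hreassoc (c : OracleCode) (a b : ℕ) (hc : ∀ n, Code.eval (toCode c)
      (Nat.pair (encode L) n) = evalPart (listOracle L) c n) : Code.eval (.comp (toCode c)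
          (.pair (.comp .left .left) (.pair (.comp .right .left) .right)))
          (Nat.pair (Nat.pair (encode L) a) b) = evalPart (listOracle L) c (Nat.pair a b) := by
    simp [eval_code_comp, eval_code_pair, eval_code_basic, hc]
  induction c generalizing n with
  | zero | succ | left | right => simp [toCode, eval_code_comp, eval_code_basic, evalPart]
  | oracle => exact eval_lookupCode L n
  | pair c d hc hd =>
    ext v
    simp [toCode, eval_code_pair, mem_evalPart_pair, hc, hd, eq_comm]
  | comp c d hc hd =>
    ext v
    simp [toCode, eval_code_comp, eval_code_pair, eval_code_basic, mem_evalPart_comp, hc, hd]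
  | prec c d hc hd =>
    rw [← Nat.pair_unpair n]
    generalize n.unpair.1 = a
    generalize n.unpair.2 = k
    rw [toCode, eval_code_comp]
    simp only [eval_code_comp, eval_code_pair, eval_code_basic, Part.bind_some, Part.map_some,
      Nat.unpair_pair]
    induction k with
    | zero => rw [evalPart_prec_zero, Code.eval_prec_zero, hc]
    | succ k ih =>
      rw [Code.eval_prec_succ]
      ext v
      rw [mem_evalPart_prec_succ, ← ih]
      simp [hreassoc d _ _ hd]
  | rfind c hc =>
    ext v
    rw [mem_evalPart_rfind, toCode, eval_code_comp]
    have hid : Code.eval Code.id (Nat.pair (encode L) n) = Part.some (Nat.pair (encode L) n) := by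
      simp
    simp only [eval_code_pair, eval_code_basic, hid, Part.bind_some, Part.map_some]
    rw [eval_code_rfind']
    refine mem_rfind_eq_zero.trans ?_
    simp only [hreassoc c _ _ hc]

end OracleCode

/-! ### Step-bounded evaluation, uniformly recursive functionals and the jump -/

namespace OracleCode

theorem primrec_toCode_ofIndex : Primrec fun e => toCode (ofIndex e) := by
  let base (k : ℕ) : Code := toCode (ofIndex k)
  let G : List Code → ℕ → Option Code := fun IH n =>
    IH[(n / 4).unpair.1]?.bind fun c₁ =>
    IH[(n / 4).unpair.2]?.bind fun c₂ =>
    IH[n / 4]?.map fun c₃ =>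
    if n % 4 = 0 then .pair c₁ c₂
    else if n % 4 = 1 then .comp c₁ (.pair .left c₂)
    else if n % 4 = 2 then .comp (.prec c₁ (.comp c₂
          (.pair (.comp .left .left) (.pair (.comp .right .left) .right))))
        (.pair (.pair .left (.comp .left .right)) (.comp .right .right))
    else .comp (.rfind' (.comp c₃
          (.pair (.comp .left .left) (.pair (.comp .right .left) .right))))
        (.pair .id .zero)
  have hG : Primrec₂ G := by
    have hn : Primrec fun p : List Code × ℕ => p.2 / 4 :=
      Primrec.nat_div.comp Primrec.snd (Primrec.const 4)
    refine Primrec.option_bind (Primrec.list_getElem?.comp Primrec.fst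
      (Primrec.fst.comp (Primrec.unpair.comp hn))) (Primrec.option_bind
      (Primrec.list_getElem?.comp (Primrec.fst.comp Primrec.fst)
        (Primrec.snd.comp (Primrec.unpair.comp (hn.comp Primrec.fst))))
      (Primrec.option_map (Primrec.list_getElem?.comp
        (Primrec.fst.comp (Primrec.fst.comp Primrec.fst))
        (hn.comp (Primrec.fst.comp Primrec.fst))) ?_))
    have hm : Primrec fun p : (((List Code × ℕ) × Code) × Code) × Code => p.1.1.1.2 % 4 :=
      Primrec.nat_mod.comp (Primrec.snd.comp (Primrec.fst.comp (Primrec.fst.comp Primrec.fst)))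
        (Primrec.const 4)
    have h1 : Primrec fun p : (((List Code × ℕ) × Code) × Code) × Code => p.1.1.2 :=
      Primrec.snd.comp (Primrec.fst.comp Primrec.fst)
    have h2 : Primrec fun p : (((List Code × ℕ) × Code) × Code) × Code => p.1.2 :=
      Primrec.snd.comp Primrec.fst
    have h3 : Primrec fun p : (((List Code × ℕ) × Code) × Code) × Code => p.2 := Primrec.snd
    refine Primrec.ite (Primrec.eq.comp hm (Primrec.const 0))
      (Code.primrec₂_pair.comp h1 h2) (Primrec.ite (Primrec.eq.comp hm (Primrec.const 1))
      (Code.primrec₂_comp.comp h1 (Code.primrec₂_pair.comp (Primrec.const _) h2))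
      (Primrec.ite (Primrec.eq.comp hm (Primrec.const 2))
      (Code.primrec₂_comp.comp (Code.primrec₂_prec.comp h1
        (Code.primrec₂_comp.comp h2 (Primrec.const _))) (Primrec.const _))
      (Code.primrec₂_comp.comp (Code.primrec_rfind'.comp
        (Code.primrec₂_comp.comp h3 (Primrec.const _))) (Primrec.const _))))
  let H : Unit → List Code → Option Code := fun _ IH =>
    if IH.length < 5 then some (((List.range 5).map base).getD IH.length .zero)
    else G IH (IH.length - 5)
  have hH : Primrec₂ H := by
    have hl : Primrec fun p : Unit × List Code => p.2.length :=
      Primrec.list_length.comp Primrec.snd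
    exact Primrec.ite (Primrec.nat_lt.comp hl (Primrec.const 5))
      (Primrec.option_some.comp ((Primrec.list_getD _).comp (Primrec.const _) hl))
      (hG.comp Primrec.snd (Primrec.nat_sub.comp hl (Primrec.const 5)))
  refine (Primrec.nat_strong_rec (fun (_ : Unit) e => toCode (ofIndex e)) hH fun _ n => ?_).comp
    (Primrec.const ()) Primrec.id
  match n with
  | 0 | 1 | 2 | 3 | 4 => simp [H, base, List.range, List.range.loop]
  | n + 5 =>
    have h1 : (n / 4).unpair.1 < n + 5 := lt_of_le_of_lt (Nat.unpair_left_le _) (by omega)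
    have h2 : (n / 4).unpair.2 < n + 5 := lt_of_le_of_lt (Nat.unpair_right_le _) (by omega)
    have h3 : n / 4 < n + 5 := by omega
    simp only [H, List.length_map, List.length_range, if_neg (show ¬ n + 5 < 5 by omega),
      Nat.add_sub_cancel, G, List.getElem?_map, List.getElem?_range h1, List.getElem?_range h2,
      List.getElem?_range h3, Option.map_some, Option.bind_some]
    rw [ofIndex]
    split_ifs <;> rfl

/-- The result of running program number `e` on input `n` for `s` steps with the initial segments
of `L` of length at most `s` as oracles: the shortest segment that yields an answer is used. -/
noncomputable def evalAt (L : List ℕ) (s e n : ℕ) : Option ℕ :=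
  ((List.range (s + 1)).filterMap fun t =>
    Code.evaln s (toCode (ofIndex e)) (Nat.pair (encode (L.take t)) n)).head?

theorem primrec_evalAt :
    Primrec fun p : (List ℕ × ℕ) × ℕ × ℕ => evalAt p.1.1 p.1.2 p.2.1 p.2.2 := by
  refine Primrec.list_head?.comp (Primrec.listFilterMap
    (Primrec.list_range.comp (Primrec.succ.comp (Primrec.snd.comp Primrec.fst))) ?_)
  exact Code.primrec_evaln.comp (Primrec.pair (Primrec.pair
    (Primrec.snd.comp (Primrec.fst.comp Primrec.fst))
    (primrec_toCode_ofIndex.comp (Primrec.fst.comp (Primrec.snd.comp Primrec.fst))))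
    (Primrec₂.natPair.comp (Primrec.encode.comp (Primrec.list_take.comp Primrec.snd
      (Primrec.fst.comp (Primrec.fst.comp Primrec.fst))))
      (Primrec.snd.comp (Primrec.snd.comp Primrec.fst))))

theorem exists_of_evalAt_eq_some {L : List ℕ} {s e n v : ℕ} (h : evalAt L s e n = some v) :
    ∃ t ≤ s, v ∈ Code.evaln s (toCode (ofIndex e)) (Nat.pair (encode (L.take t)) n) := by
  have := List.mem_of_mem_head? (Option.mem_def.2 h)
  obtain ⟨t, ht, hv⟩ := List.mem_filterMap.1 this
  exact ⟨t, by simpa [Nat.lt_succ_iff] using ht, hv⟩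

theorem mem_eval_of_mem_evaln {g : ℕ → ℕ} {s e n v t : ℕ}
    (h : v ∈ Code.evaln s (toCode (ofIndex e)) (Nat.pair (encode (restrict g t)) n)) :
    v ∈ eval g (ofIndex e) n :=
  mem_eval_iff_exists_restrict.2 ⟨t, eval_toCode (restrict g t) _ _ ▸ Code.evaln_sound h⟩

theorem evalAt_sound {g : ℕ → ℕ} {s u e n v : ℕ} (hs : s ≤ u)
    (h : evalAt (restrict g u) s e n = some v) : v ∈ eval g (ofIndex e) n := by
  obtain ⟨t, ht, hv⟩ := exists_of_evalAt_eq_some h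
  rw [take_restrict g (ht.trans hs)] at hv
  exact mem_eval_of_mem_evaln hv

/-- If finite approximations converge to an oracle, then the step-bounded computations with these
approximations converge to the computation with the oracle. -/
theorem eventually_evalAt {g : ℕ → ℕ} {L : ℕ → List ℕ}
    (hL : ∀ t, ∀ᶠ s in Filter.atTop, (L s).take t = restrict g t) {e n v : ℕ}
    (h : v ∈ eval g (ofIndex e) n) : ∀ᶠ s in Filter.atTop, evalAt (L s) s e n = some v := by
  obtain ⟨t, ht⟩ := mem_eval_iff_exists_restrict.1 h
  rw [← eval_toCode] at ht
  obtain ⟨k, hk⟩ := Code.evaln_complete.1 ht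
  have hall : ∀ᶠ s in Filter.atTop, ∀ u ∈ Finset.range (t + 1), (L s).take u = restrict g u :=
    (Filter.eventually_all_finset _).2 fun u _ => hL u
  filter_upwards [hall, Filter.eventually_ge_atTop k, Filter.eventually_ge_atTop t]
    with s hs hks hts
  -- every segment shorter than `t` is already correct, so the first answer found is correct
  have key : ∀ (l : List ℕ), l.Pairwise (· < ·) → t ∈ l →
      (l.filterMap fun t => Code.evaln s (toCode (ofIndex e))
        (Nat.pair (encode ((L s).take t)) n)).head? = some v := by
    intro l
    induction l with
    | nil => simp
    | cons u l ih =>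
      intro hl hmem
      rw [List.filterMap_cons]
      have hut : u ≤ t := by
        rcases List.mem_cons.1 hmem with rfl | hmem
        · exact le_rfl
        · exact ((List.pairwise_cons.1 hl).1 _ hmem).le
      rw [hs u (by simpa [Nat.lt_succ_iff] using hut)]
      cases hw : Code.evaln s (toCode (ofIndex e)) (Nat.pair (encode (restrict g u)) n) with
      | some w => simpa using Part.mem_unique (mem_eval_of_mem_evaln hw) h
      | none =>
        rcases List.mem_cons.1 hmem with rfl | hmem
        · rw [Code.evaln_mono hks hk] at hw
          exact absurd hw (by simp)
        · exact ih (List.pairwise_cons.1 hl).2 hmem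
  exact key _ List.pairwise_lt_range (by simpa [Nat.lt_succ_iff] using hts)

theorem eventually_take_restrict (g : ℕ → ℕ) (t : ℕ) :
    ∀ᶠ s in Filter.atTop, (restrict g s).take t = restrict g t := by
  filter_upwards [Filter.eventually_ge_atTop t] with s hs using take_restrict g hs

end OracleCode

theorem mem_jump_iff {g : ℕ → ℕ} {e : ℕ} : e ∈ jump g ↔ ((ofIndex e).eval g e).Dom := by
  constructor
  · rintro ⟨c, rfl, h⟩
    rwa [ofIndex_index]
  · exact fun h => ⟨_, index_ofIndex e, h⟩

/-- A functional from total oracles to partial functions that is computed by one program. -/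
def UniformlyRecursive (f : (ℕ → ℕ) → ℕ →. ℕ) : Prop :=
  ∃ c : OracleCode, ∀ g, c.eval g = f g

namespace UniformlyRecursive

theorem of_partrec {f : ℕ →. ℕ} (hf : Nat.Partrec f) : UniformlyRecursive fun _ => f := by
  induction hf with
  | zero => exact ⟨.zero, fun _ => rfl⟩
  | succ => exact ⟨.succ, fun _ => rfl⟩
  | left => exact ⟨.left, fun _ => rfl⟩
  | right => exact ⟨.right, fun _ => rfl⟩
  | pair _ _ h₁ h₂ =>
    obtain ⟨c, hc⟩ := h₁
    obtain ⟨d, hd⟩ := h₂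
    exact ⟨.pair c d, fun g => by simp only [eval, hc, hd]; rfl⟩
  | comp _ _ h₁ h₂ =>
    obtain ⟨c, hc⟩ := h₁
    obtain ⟨d, hd⟩ := h₂
    exact ⟨.comp c d, fun g => by simp only [eval, hc, hd]; rfl⟩
  | prec _ _ h₁ h₂ =>
    obtain ⟨c, hc⟩ := h₁
    obtain ⟨d, hd⟩ := h₂
    exact ⟨.prec c d, fun g => by simp only [eval, hc, hd]; rfl⟩
  | rfind _ h₁ =>
    obtain ⟨c, hc⟩ := h₁
    exact ⟨.rfind c, fun g => by simp only [eval, hc]; rfl⟩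

theorem of_computable {f : ℕ → ℕ} (hf : Computable f) :
    UniformlyRecursive fun _ n => Part.some (f n) :=
  of_partrec (Partrec.nat_iff.1 hf)

theorem oracle : UniformlyRecursive fun g n => Part.some (g n) := ⟨.oracle, fun _ => rfl⟩

theorem comp {f h : (ℕ → ℕ) → ℕ →. ℕ} (hf : UniformlyRecursive f) (hh : UniformlyRecursive h) :
    UniformlyRecursive fun g n => (h g n).bind fun a => f g a := by
  obtain ⟨c, hc⟩ := hf
  obtain ⟨d, hd⟩ := hh
  exact ⟨.comp c d, fun g => by simp only [eval, hc, hd]; rfl⟩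

/-- Uniformly recursive total functions are closed under composition with computable functions of
two arguments. -/
theorem computable₂ {F : ℕ → ℕ → ℕ} (hF : Computable₂ F) {f h : (ℕ → ℕ) → ℕ → ℕ}
    (hf : UniformlyRecursive fun g n => Part.some (f g n))
    (hh : UniformlyRecursive fun g n => Part.some (h g n)) :
    UniformlyRecursive fun g n => Part.some (F (f g n) (h g n)) := by
  obtain ⟨c, hc⟩ := hf
  obtain ⟨d, hd⟩ := hh
  have hp : UniformlyRecursive fun g n => Part.some (Nat.pair (f g n) (h g n)) :=
    ⟨.pair c d, fun g => by
      funext n; simp [eval, hc, hd, Seq.seq]⟩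
  have := comp (of_computable (f := fun p => F p.unpair.1 p.unpair.2)
    (hF.comp (Computable.fst.comp Computable.unpair) (Computable.snd.comp Computable.unpair))) hp
  simpa using this

/-- Primitive recursion without parameters. -/
theorem nat_rec {f : (ℕ → ℕ) → ℕ → ℕ} (a : ℕ)
    (hf : UniformlyRecursive fun g p => Part.some (f g p)) :
    UniformlyRecursive fun g n => Part.some (n.rec a (fun y i => f g (Nat.pair y i)) : ℕ) := by
  obtain ⟨c, hc⟩ := hf
  obtain ⟨d, hd⟩ := of_computable (Computable.const a)
  obtain ⟨p, hp⟩ := of_computable (f := fun n => Nat.pair 0 n)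
    (Primrec.to_comp (Primrec₂.natPair.comp (Primrec.const 0) Primrec.id))
  refine ⟨.comp (.prec d (.comp c .right)) p, fun g => ?_⟩
  funext n
  simp only [eval, hp, hc, hd, Part.bind_eq_bind, Part.bind_some, Nat.unpair_pair]
  induction n with
  | zero => rfl
  | succ n ih =>
    simp only at ih ⊢
    rw [ih]
    simp

/-- The coded initial segments of the oracle. -/
theorem encode_restrict : UniformlyRecursive fun g n => Part.some (encode (restrict g n)) := by
  have hF : Computable₂ fun p b : ℕ =>
      encode ((decode p.unpair.2 : Option (List ℕ)).getD [] ++ [b]) :=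
    Primrec.to_comp (Primrec.encode.comp (Primrec.list_append.comp
      (Primrec.option_getD.comp (Primrec.decode.comp
        (Primrec.snd.comp (Primrec.unpair.comp Primrec.fst))) (Primrec.const []))
      (Primrec.list_cons.comp Primrec.snd (Primrec.const []))))
  have hb : UniformlyRecursive fun g p => Part.some (g p.unpair.1) := by
    simpa using oracle.comp (of_computable (Computable.fst.comp Computable.unpair))
  obtain ⟨c, hc⟩ := nat_rec (encode ([] : List ℕ))
    (computable₂ hF (of_computable Computable.id) hb)
  refine ⟨c, fun g => (hc g).trans ?_⟩
  funext n
  rw [Part.some_inj]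
  induction n with
  | zero => rfl
  | succ n ih => simp only at ih ⊢; rw [ih]; simp [restrict, List.range_succ]

/-- Unbounded search over longer and longer initial segments of the oracle. -/
theorem search {Ψ : List ℕ → ℕ → Option ℕ} (hΨ : Computable₂ Ψ) :
    UniformlyRecursive fun g n => Nat.rfindOpt fun s => Ψ (restrict g s) n := by
  have hdec : Computable fun x : ℕ => (decode x.unpair.1 : Option (List ℕ)).getD [] :=
    Primrec.to_comp (Primrec.option_getD.comp
      (Primrec.decode.comp (Primrec.fst.comp Primrec.unpair)) (Primrec.const []))
  have hopt : Computable fun x : ℕ => Ψ ((decode x.unpair.1).getD []) x.unpair.2 :=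
    hΨ.comp hdec (Computable.snd.comp Computable.unpair)
  have hpair : UniformlyRecursive fun g p =>
      Part.some (Nat.pair (encode (restrict g p.unpair.2)) p.unpair.1) := by
    refine computable₂ (f := fun g p => encode (restrict g p.unpair.2)) (h := fun _ p => p.unpair.1)
      Primrec₂.natPair.to_comp ?_
      (of_computable (Computable.fst.comp Computable.unpair))
    simpa using encode_restrict.comp (of_computable (Computable.snd.comp Computable.unpair))
  obtain ⟨c, hc⟩ := (of_computable (f := fun x => bif
      (Ψ ((decode x.unpair.1).getD []) x.unpair.2).isSome then 0 else 1)
    (Computable.cond (Primrec.option_isSome.to_comp.comp hopt) (Computable.const 0)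
      (Computable.const 1))).comp hpair
  obtain ⟨d, hd⟩ := (of_partrec (Partrec.nat_iff.1 (Computable.ofOption hopt))).comp hpair
  refine ⟨.comp d (.pair (.pair .left .right) (.rfind c)), fun g => ?_⟩
  funext n
  simp only [eval, hc, hd, Nat.rfindOpt]
  have hbif (b : Bool) : decide ((bif b then 0 else 1) = 0) = b := by cases b <;> rfl
  simp [Seq.seq, hbif]

end UniformlyRecursive

theorem turingReducible_iff_exists_eval {g : ℕ → ℕ} {f : ℕ →. ℕ} :
    f ≤ᵀ (g : ℕ →. ℕ) ↔ ∃ c : OracleCode, c.eval g = f :=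
  RecursiveIn.iff_nat.trans (exists_eval_iff g f).symm

theorem UniformlyRecursive.turingReducible {f : (ℕ → ℕ) → ℕ →. ℕ} (hf : UniformlyRecursive f)
    (g : ℕ → ℕ) : f g ≤ᵀ (g : ℕ →. ℕ) := by
  obtain ⟨c, hc⟩ := hf
  exact turingReducible_iff_exists_eval.2 ⟨c, hc g⟩

/-- The program that ignores its input and outputs the number `n`. -/
def constCode : ℕ → OracleCode
  | 0 => .zero
  | n + 1 => .comp .succ (constCode n)

theorem eval_constCode (g : ℕ → ℕ) (n m : ℕ) : (constCode n).eval g m = Part.some n := by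
  induction n with
  | zero => rfl
  | succ n ih => simp [constCode, eval, ih]

theorem primrec_index_constCode : Primrec fun n => (constCode n).index := by
  have : Primrec (Nat.rec 0 fun _ i => 4 * Nat.pair 1 i + 6 : ℕ → ℕ) :=
    Primrec.nat_rec₁ _ (Primrec.nat_add.comp (Primrec.nat_mul.comp (Primrec.const 4)
      (Primrec₂.natPair.comp (Primrec.const 1) Primrec.snd)) (Primrec.const 6))
  refine this.of_eq fun n => ?_
  induction n with
  | zero => rfl
  | succ n ih => simp only [constCode, index] at ih ⊢; rw [ih]

/-- The jump answers, uniformly in the oracle, whether a uniformly recursive function halts. -/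
theorem UniformlyRecursive.exists_mem_jump_iff {f : (ℕ → ℕ) → ℕ →. ℕ}
    (hf : UniformlyRecursive f) :
    ∃ h : ℕ → ℕ, Primrec h ∧ ∀ g n, h n ∈ jump g ↔ (f g n).Dom := by
  obtain ⟨c, hc⟩ := hf
  refine ⟨fun n => (OracleCode.comp c (constCode n)).index, ?_, fun g n => ?_⟩
  · exact Primrec.nat_add.comp (Primrec.nat_mul.comp (Primrec.const 4)
      (Primrec₂.natPair.comp (Primrec.const _) primrec_index_constCode)) (Primrec.const 6)
  · rw [mem_jump_iff, ofIndex_index]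
    have : eval g (.comp c (constCode n)) (OracleCode.comp c (constCode n)).index =
        (Part.some n).bind fun a => f g a := by
      rw [← eval_constCode g n, ← hc]
      rfl
    rw [this, Part.bind_some]

/-- The jump decides, uniformly in the oracle, the existential properties of the oracle. -/
theorem exists_mem_jump_iff_of_primrecRel {R : List ℕ → ℕ → Prop} (hR : PrimrecRel R) :
    ∃ h : ℕ → ℕ, Primrec h ∧ ∀ g n, h n ∈ jump g ↔ ∃ s, R (restrict g s) n := by
  classical
  have hΨ : Computable₂ fun L n => if R L n then some 0 else (none : Option ℕ) :=
    Primrec.to_comp (Primrec.ite hR (Primrec.const _) (Primrec.const _))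
  obtain ⟨h, hh, hj⟩ := (UniformlyRecursive.search hΨ).exists_mem_jump_iff
  refine ⟨h, hh, fun g n => (hj g n).trans (Nat.rfindOpt_dom.trans ?_)⟩
  simp

/-- The diagonal halting function is uniformly recursive. -/
theorem uniformlyRecursive_diagonal :
    UniformlyRecursive fun g e => (ofIndex e).eval g e := by
  obtain ⟨c, hc⟩ := UniformlyRecursive.search (Ψ := fun L e => evalAt L L.length e e)
    (Primrec.to_comp (primrec_evalAt.comp (Primrec.pair
      (Primrec.pair Primrec.fst (Primrec.list_length.comp Primrec.fst))
      (Primrec.pair Primrec.snd Primrec.snd))))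
  refine ⟨c, fun g => (hc g).trans ?_⟩
  funext e
  have hsound : ∀ v, (∃ s, v ∈ evalAt (restrict g s) s e e) → v ∈ (ofIndex e).eval g e :=
    fun v ⟨s, hs⟩ => evalAt_sound le_rfl hs
  ext v
  simp only [length_restrict]
  constructor
  · exact fun h => hsound v (Nat.rfindOpt_spec h)
  · intro h
    obtain ⟨s, hs⟩ := (eventually_evalAt (eventually_take_restrict g) h).exists
    obtain ⟨w, hw⟩ := Part.dom_iff_mem.1
      (Nat.rfindOpt_dom (f := fun s => evalAt (restrict g s) s e e).2
      ⟨s, v, hs⟩)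
    rwa [Part.mem_unique h (hsound w (Nat.rfindOpt_spec hw))]

theorem turingReducible_comp {f : ℕ → ℕ} {g : ℕ → ℕ} {h : ℕ → ℕ} (hh : Primrec h)
    (H : ∀ n, f n = g (h n)) : (f : ℕ →. ℕ) ≤ᵀ (g : ℕ →. ℕ) := by
  have := (UniformlyRecursive.oracle.comp (.of_computable hh.to_comp)).turingReducible g
  refine this.of_eq fun n => ?_
  simp [H]

theorem chi_eq_chi {A B : Set ℕ} {m n : ℕ} (h : m ∈ A ↔ n ∈ B) : chi A m = chi B n := by
  classical
  unfold chi
  exact if_congr h rfl rfl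

/-- The Turing jump is monotone. -/
theorem jump_mono {f g : ℕ → ℕ} (h : (f : ℕ →. ℕ) ≤ᵀ (g : ℕ →. ℕ)) :
    (chi (jump f) : ℕ →. ℕ) ≤ᵀ (chi (jump g) : ℕ →. ℕ) := by
  obtain ⟨c, hc⟩ := turingReducible_iff_exists_eval.1
    ((uniformlyRecursive_diagonal.turingReducible f).trans h)
  obtain ⟨k, hk, hj⟩ := UniformlyRecursive.exists_mem_jump_iff ⟨c, fun _ => rfl⟩
  refine turingReducible_comp hk fun e => chi_eq_chi ?_
  rw [mem_jump_iff, hj, hc]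

/-! ### The low basis theorem -/

section BoundedQuantifiers

variable {α β : Type*} [Primcodable α] [Primcodable β]

theorem primrecPred_exists_mem {f : α → List β} {R : β → α → Prop} (hf : Primrec f)
    (hR : PrimrecPred fun p : β × α => R p.1 p.2) : PrimrecPred fun a => ∃ b ∈ f a, R b a :=
  PrimrecRel.comp (PrimrecRel.exists_mem_list hR) hf Primrec.id

theorem primrecPred_forall_mem {f : α → List β} {R : β → α → Prop} (hf : Primrec f)
    (hR : PrimrecPred fun p : β × α => R p.1 p.2) : PrimrecPred fun a => ∀ b ∈ f a, R b a :=
  PrimrecRel.comp (PrimrecRel.forall_mem_list hR) hf Primrec.id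

theorem primrecPred_exists_lt {f : α → ℕ} {R : ℕ → α → Prop} (hf : Primrec f)
    (hR : PrimrecPred fun p : ℕ × α => R p.1 p.2) : PrimrecPred fun a => ∃ m < f a, R m a :=
  (primrecPred_exists_mem (Primrec.list_range.comp hf) hR).of_eq fun a => by simp

theorem primrecPred_forall_lt {f : α → ℕ} {R : ℕ → α → Prop} (hf : Primrec f)
    (hR : PrimrecPred fun p : ℕ × α => R p.1 p.2) : PrimrecPred fun a => ∀ m < f a, R m a :=
  (primrecPred_forall_mem (Primrec.list_range.comp hf) hR).of_eq fun a => by simp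

end BoundedQuantifiers

/-- All strings of a given length. -/
def strings : ℕ → List (List (Fin 4))
  | 0 => [[]]
  | m + 1 => (strings m).flatMap fun ρ => (List.finRange 4).map fun a => a :: ρ

theorem mem_strings {m : ℕ} {ρ : List (Fin 4)} : ρ ∈ strings m ↔ ρ.length = m := by
  induction m generalizing ρ with
  | zero => simp [strings]
  | succ m ih => cases ρ <;> simp [strings, ih]

theorem primrec_strings : Primrec strings := by
  have : Primrec (Nat.rec [[]] fun _ l => l.flatMap fun ρ =>
      (List.finRange 4).map fun a => a :: ρ : ℕ → List (List (Fin 4))) := by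
    refine Primrec.nat_rec₁ _ (Primrec.list_flatMap Primrec.snd ?_)
    exact Primrec.list_map (Primrec.const _)
      (Primrec.list_cons.comp Primrec.snd (Primrec.snd.comp Primrec.fst))
  refine this.of_eq fun n => ?_
  induction n with
  | zero => rfl
  | succ n ih => simp only [strings] at ih ⊢; rw [ih]

/-- Program number `e` halts on input `e` within `|τ|` steps with oracle the string `τ`. -/
def HaltsOn (τ : List (Fin 4)) (e : ℕ) : Prop :=
  (evalAt (τ.map Fin.val) τ.length e e).isSome = true

theorem primrecRel_haltsOn : PrimrecRel HaltsOn := by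
  refine Primrec.eq.comp (Primrec.option_isSome.comp (primrec_evalAt.comp (Primrec.pair
    (Primrec.pair (Primrec.list_map Primrec.fst (Primrec.fin_val.comp Primrec.snd).to₂)
      (Primrec.list_length.comp Primrec.fst))
    (Primrec.pair Primrec.snd Primrec.snd)))) (Primrec.const true)

theorem isSome_evalAt {L : List ℕ} {s e n : ℕ} : (evalAt L s e n).isSome = true ↔
    ∃ t ≤ s, ∃ v, v ∈ Code.evaln s (toCode (ofIndex e)) (Nat.pair (encode (L.take t)) n) := by
  rw [evalAt, List.isSome_head?, ne_eq, List.filterMap_eq_nil_iff]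
  simp [← Option.isSome_iff_exists, Option.isSome_iff_ne_none]

theorem HaltsOn.mono {τ τ' : List (Fin 4)} {e : ℕ} (h : HaltsOn τ e) (hτ : τ <+: τ') :
    HaltsOn τ' e := by
  obtain ⟨t, ht, v, hv⟩ := isSome_evalAt.1 h
  refine isSome_evalAt.2 ⟨t, ht.trans hτ.length_le, v, Code.evaln_mono hτ.length_le ?_⟩
  obtain ⟨ρ, rfl⟩ := hτ
  rwa [List.map_append, List.take_append_of_le_length (by simpa using ht)]

theorem restrict_pathFun (f : ℕ → Fin 4) (n : ℕ) :
    restrict (pathFun f) n = ((List.range n).map f).map Fin.val := by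
  simp [restrict, pathFun]

theorem mem_jump_pathFun {f : ℕ → Fin 4} {e : ℕ} :
    e ∈ jump (pathFun f) ↔ ∃ n, HaltsOn ((List.range n).map f) e := by
  simp only [HaltsOn, ← restrict_pathFun, List.length_map, List.length_range]
  rw [mem_jump_iff, Part.dom_iff_mem]
  constructor
  · rintro ⟨v, hv⟩
    obtain ⟨s, hs⟩ := (eventually_evalAt (eventually_take_restrict _) hv).exists
    exact ⟨s, by simp [hs]⟩
  · rintro ⟨n, hn⟩
    obtain ⟨v, hv⟩ := Option.isSome_iff_exists.1 hn
    exact ⟨v, evalAt_sound le_rfl hv⟩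

theorem range_map_prefix {f : ℕ → Fin 4} {m n : ℕ} (h : m ≤ n) :
    (List.range m).map f <+: (List.range n).map f := by
  refine List.IsPrefix.map f ?_
  rw [← Nat.min_eq_left h, ← List.take_range]
  exact List.take_prefix _ _

/-- The tree `T` has strings of every length above `σ` on which none of the programs with index
in `E` halts. -/
def Large (T : Set (List (Fin 4))) (q : List ℕ × List (Fin 4)) : Prop :=
  ∀ m, ∃ ρ : List (Fin 4), ρ.length = m ∧ q.2 ++ ρ ∈ T ∧ ∀ e ∈ q.1, ¬ HaltsOn (q.2 ++ ρ) e

theorem large_nil {T : Set (List (Fin 4))} (hT : IsTree T) (hinf : T.Infinite) :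
    Large T ([], []) := by
  intro m
  obtain ⟨σ, hσ, hlen⟩ : ∃ σ ∈ T, m ≤ σ.length := by
    by_contra! h
    exact hinf ((List.finite_length_lt (Fin 4) m).subset h)
  exact ⟨σ.take m, by simpa using hlen, hT _ _ (List.take_prefix _ _) hσ, by simp⟩

/-- König's step: an infinite tree is infinite above one of the immediate successors. -/
theorem Large.exists_concat {T : Set (List (Fin 4))} (hT : IsTree T) {E : List ℕ}
    {σ : List (Fin 4)} (h : Large T (E, σ)) : ∃ a, Large T (E, σ ++ [a]) := by
  by_contra! hno
  simp only [Large, not_forall] at hno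
  choose m hm using hno
  obtain ⟨ρ, hlen, hmem, hE⟩ := h (Finset.univ.sup m + 1)
  cases ρ with
  | nil => simp at hlen
  | cons a ρ =>
    have hp : σ ++ [a] ++ ρ.take (m a) <+: σ ++ a :: ρ := by
      simpa using List.take_prefix _ _
    refine hm a ⟨ρ.take (m a), ?_, hT _ _ hp hmem, fun e he hh => hE e he (hh.mono hp)⟩
    have := Finset.le_sup (f := m) (Finset.mem_univ a)
    simp at hlen ⊢
    omega

theorem Large.mem {T : Set (List (Fin 4))} {q : List ℕ × List (Fin 4)} (h : Large T q) :
    q.2 ∈ T ∧ ∀ e ∈ q.1, ¬ HaltsOn q.2 e := by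
  obtain ⟨ρ, hlen, h1, h2⟩ := h 0
  obtain rfl := List.eq_nil_of_length_eq_zero hlen
  rw [List.append_nil] at h1 h2
  exact ⟨h1, h2⟩

theorem treeOracle_encode {T : Set (List (Fin 4))} {σ : List (Fin 4)} :
    treeOracle T (encode σ) = 0 ↔ σ ∉ T := by
  simp [treeOracle, chi]

/-- A finite amount of information about a tree that refutes `Large`. -/
def RefutesLarge (L : List ℕ) (n : ℕ) : Prop :=
  ∃ m < L.length, ∀ ρ ∈ strings m,
    L[encode (((decode n : Option (List ℕ × List (Fin 4))).getD default).2 ++ ρ)]? = some 0 ∨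
      ∃ e ∈ ((decode n : Option (List ℕ × List (Fin 4))).getD default).1,
        HaltsOn (((decode n : Option (List ℕ × List (Fin 4))).getD default).2 ++ ρ) e

theorem primrecRel_refutesLarge : PrimrecRel RefutesLarge := by
  have hd : Primrec fun n => (decode n : Option (List ℕ × List (Fin 4))).getD default :=
    Primrec.option_getD.comp Primrec.decode (Primrec.const _)
  have happ : Primrec fun p : List (Fin 4) × (List ℕ × ℕ) =>
      ((decode p.2.2 : Option (List ℕ × List (Fin 4))).getD default).2 ++ p.1 :=
    Primrec.list_append.comp
      (Primrec.snd.comp (hd.comp (Primrec.snd.comp Primrec.snd))) Primrec.fst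
  have h1 : PrimrecPred fun p : List (Fin 4) × (List ℕ × ℕ) =>
      p.2.1[encode (((decode p.2.2 : Option (List ℕ × List (Fin 4))).getD default).2 ++ p.1)]? =
        some 0 :=
    Primrec.eq.comp (Primrec.list_getElem?.comp (Primrec.fst.comp Primrec.snd)
      (Primrec.encode.comp happ)) (Primrec.const _)
  have h2 : PrimrecPred fun p : List (Fin 4) × (List ℕ × ℕ) =>
      ∃ e ∈ ((decode p.2.2 : Option (List ℕ × List (Fin 4))).getD default).1,
        HaltsOn (((decode p.2.2 : Option (List ℕ × List (Fin 4))).getD default).2 ++ p.1) e :=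
    primrecPred_exists_mem (Primrec.fst.comp (hd.comp (Primrec.snd.comp Primrec.snd)))
      (primrecRel_haltsOn.comp (happ.comp Primrec.snd) Primrec.fst)
  exact primrecPred_exists_lt (Primrec.list_length.comp Primrec.fst)
    (primrecPred_forall_mem (primrec_strings.comp Primrec.fst)
      ((h1.or h2).comp (Primrec.pair Primrec.fst (Primrec.snd.comp Primrec.snd))))

theorem exists_refutesLarge_iff {T : Set (List (Fin 4))} {q : List ℕ × List (Fin 4)} :
    (∃ s, RefutesLarge (restrict (treeOracle T) s) (encode q)) ↔ ¬ Large T q := by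
  simp only [RefutesLarge, encodek, Option.getD_some, length_restrict, mem_strings]
  constructor
  · rintro ⟨s, m, -, h⟩ hl
    obtain ⟨ρ, hlen, hmem, hE⟩ := hl m
    rcases h ρ hlen with h | ⟨e, he, hh⟩
    · have hlt : encode (q.2 ++ ρ) < s := by
        by_contra hge
        simp [restrict, hge] at h
      rw [getElem?_restrict hlt, Option.some_inj, treeOracle_encode] at h
      exact h hmem
    · exact hE e he hh
  · intro h
    simp only [Large, not_forall] at h
    obtain ⟨m, hm⟩ := h
    have hfin := List.finite_length_eq (Fin 4) m
    obtain ⟨s, hs⟩ := (hfin.image fun ρ => encode (q.2 ++ ρ)).bddAbove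
    refine ⟨max s m + 1, m, by omega, fun ρ hρ => ?_⟩
    rw [getElem?_restrict (lt_of_le_of_lt (hs ⟨ρ, hρ, rfl⟩) (by omega)), Option.some_inj,
      treeOracle_encode]
    by_contra! hno
    exact hm ⟨ρ, hρ, hno⟩

/-- A jump question whose negative answer means that `Large` holds. -/
noncomputable def largeQuery : ℕ → ℕ :=
  (exists_mem_jump_iff_of_primrecRel primrecRel_refutesLarge).choose

theorem primrec_largeQuery : Primrec largeQuery :=
  (exists_mem_jump_iff_of_primrecRel primrecRel_refutesLarge).choose_spec.1

/-- The jump of a tree, as an oracle. -/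
noncomputable abbrev treeJump (T : Set (List (Fin 4))) : ℕ → ℕ := chi (jump (treeOracle T))

theorem chi_jump_largeQuery {T : Set (List (Fin 4))} {q : List ℕ × List (Fin 4)} :
    treeJump T (largeQuery (encode q)) = 0 ↔ Large T q := by
  have h := (exists_mem_jump_iff_of_primrecRel primrecRel_refutesLarge).choose_spec.2
    (treeOracle T) (encode q)
  rw [exists_refutesLarge_iff] at h
  change largeQuery (encode q) ∈ _ ↔ _ at h
  simp [treeJump, chi, h]

/-- The first part of a step of the low basis construction: keep program `i` from halting if this
leaves the tree infinite. -/
noncomputable def avoidStep (O : ℕ → ℕ) (i : ℕ) (q : List ℕ × List (Fin 4)) :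
    List ℕ × List (Fin 4) :=
  (if O (largeQuery (encode (i :: q.1, q.2))) = 0 then i :: q.1 else q.1, q.2)

/-- The least digit above which the tree is still infinite. -/
noncomputable def nextDigit (O : ℕ → ℕ) (q : List ℕ × List (Fin 4)) : Fin 4 :=
  if O (largeQuery (encode (q.1, q.2 ++ [0]))) = 0 then 0
  else if O (largeQuery (encode (q.1, q.2 ++ [1]))) = 0 then 1
  else if O (largeQuery (encode (q.1, q.2 ++ [2]))) = 0 then 2
  else 3

/-- The list of programs kept from halting and the initial segment of the path after `i` steps of
the low basis construction. -/
noncomputable def lowStage (O : ℕ → ℕ) : ℕ → List ℕ × List (Fin 4)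
  | 0 => ([], [])
  | i + 1 =>
    let q := avoidStep O i (lowStage O i)
    (q.1, q.2 ++ [nextDigit O q])

/-- The path chosen by the low basis construction. -/
noncomputable def lowPath (T : Set (List (Fin 4))) (i : ℕ) : Fin 4 :=
  nextDigit (treeJump T)
    (avoidStep (treeJump T) i (lowStage (treeJump T) i))

theorem large_avoidStep {T : Set (List (Fin 4))} {i : ℕ} {q : List ℕ × List (Fin 4)}
    (h : Large T q) :
    Large T (avoidStep (treeJump T) i q) := by
  unfold avoidStep
  split_ifs with h0
  · exact chi_jump_largeQuery.1 h0
  · exact h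

theorem large_concat_nextDigit {T : Set (List (Fin 4))} (hT : IsTree T)
    {q : List ℕ × List (Fin 4)} (h : Large T q) :
    Large T (q.1, q.2 ++ [nextDigit (treeJump T) q]) := by
  unfold nextDigit
  split_ifs with h0 h1 h2
  · exact chi_jump_largeQuery.1 h0
  · exact chi_jump_largeQuery.1 h1
  · exact chi_jump_largeQuery.1 h2
  · rw [chi_jump_largeQuery] at h0 h1 h2
    obtain ⟨a, ha⟩ := h.exists_concat hT
    fin_cases a
    · exact absurd ha h0
    · exact absurd ha h1
    · exact absurd ha h2
    · exact ha

theorem large_lowStage {T : Set (List (Fin 4))} (hT : IsTree T) (hinf : T.Infinite)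
    (n : ℕ) : Large T (lowStage (treeJump T) n) := by
  induction n with
  | zero => exact large_nil hT hinf
  | succ n ih => exact large_concat_nextDigit hT (large_avoidStep ih)

theorem lowStage_snd (T : Set (List (Fin 4))) (n : ℕ) :
    (lowStage (treeJump T) n).2 = (List.range n).map (lowPath T) := by
  induction n with
  | zero => rfl
  | succ n ih =>
    rw [List.range_succ, List.map_append, ← ih]
    rfl

theorem lowStage_fst_mono (O : ℕ → ℕ) {m n : ℕ} (h : m ≤ n) :
    (lowStage O m).1 ⊆ (lowStage O n).1 := by
  induction n, h using Nat.le_induction with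
  | base => exact List.Subset.refl _
  | succ n _ ih =>
    refine List.Subset.trans ih fun e he => ?_
    simp only [lowStage, avoidStep]
    split_ifs
    · exact List.mem_cons_of_mem _ he
    · exact he

theorem isPath_lowPath {T : Set (List (Fin 4))} (hT : IsTree T)
    (hinf : T.Infinite) : IsPath (lowPath T) T := fun n => by
  rw [← lowStage_snd]
  exact (large_lowStage hT hinf n).mem.1

/-- The construction decides the jump of the path it builds. -/
theorem mem_jump_lowPath {T : Set (List (Fin 4))} (hT : IsTree T)
    (hinf : T.Infinite) {e : ℕ} :
    e ∈ jump (pathFun (lowPath T)) ↔ e ∉ (lowStage (treeJump T) (e + 1)).1 := by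
  rw [mem_jump_pathFun]
  constructor
  · rintro ⟨n, hn⟩ he
    refine (large_lowStage hT hinf (max n (e + 1))).mem.2 e
      (lowStage_fst_mono _ (le_max_right _ _) he) ?_
    rw [lowStage_snd]
    exact hn.mono (range_map_prefix (le_max_left _ _))
  · intro he
    have hnot : ¬ Large T (e :: (lowStage (treeJump T) e).1, (lowStage (treeJump T) e).2) := by
      intro h
      refine he ?_
      simp only [lowStage, avoidStep]
      rw [if_pos (chi_jump_largeQuery.2 h)]
      exact List.mem_cons_self
    simp only [Large, not_forall] at hnot
    obtain ⟨m, hm⟩ := hnot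
    -- the path extends the current string and avoids halting of the earlier programs
    have hl := (large_lowStage hT hinf (e + m)).mem
    have hpre : (lowStage (treeJump T) e).2 <+: (lowStage (treeJump T) (e + m)).2 := by
      rw [lowStage_snd, lowStage_snd]
      exact range_map_prefix (Nat.le_add_right _ _)
    obtain ⟨ρ, hρ⟩ := hpre
    have hlen : ρ.length = m := by
      have := congrArg List.length hρ
      simpa [lowStage_snd] using this
    by_contra hno
    refine hm ⟨ρ, hlen, hρ ▸ hl.1, fun e' he' hh => ?_⟩
    rw [hρ] at hh
    rcases List.mem_cons.1 he' with rfl | he'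
    · exact hno ⟨_, lowStage_snd T _ ▸ hh⟩
    · exact hl.2 e' (lowStage_fst_mono _ (Nat.le_add_right _ _) he') hh

namespace UniformlyRecursive

theorem comp_total {f h : (ℕ → ℕ) → ℕ → ℕ} (hf : UniformlyRecursive fun g n => Part.some (f g n))
    (hh : UniformlyRecursive fun g n => Part.some (h g n)) :
    UniformlyRecursive fun g n => Part.some (f g (h g n)) := by
  simpa using hf.comp hh

theorem oracle_computable {k : ℕ → ℕ} (hk : Computable k) :
    UniformlyRecursive fun g n => Part.some (g (k n)) :=
  oracle.comp_total (of_computable hk)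

end UniformlyRecursive

/-- The pair coded by a natural number. -/
def decodeStage (n : ℕ) : List ℕ × List (Fin 4) := (decode n).getD default

@[simp] theorem decodeStage_encode (q : List ℕ × List (Fin 4)) : decodeStage (encode q) = q := by
  simp [decodeStage]

theorem primrec_decodeStage : Primrec decodeStage :=
  Primrec.option_getD.comp Primrec.decode (Primrec.const _)

theorem uniformlyRecursive_avoidStep :
    UniformlyRecursive fun g p =>
      Part.some (encode (avoidStep g p.unpair.1 (decodeStage p.unpair.2))) := by
  have h2 : Primrec fun p : ℕ => decodeStage p.unpair.2 :=
    primrec_decodeStage.comp (Primrec.snd.comp Primrec.unpair)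
  have hq : Primrec fun p : ℕ => (p.unpair.1 :: (decodeStage p.unpair.2).1) :=
    Primrec.list_cons.comp (Primrec.fst.comp Primrec.unpair) (Primrec.fst.comp h2)
  refine UniformlyRecursive.computable₂ (F := fun p b => encode
    ((if b = 0 then (p.unpair.1 :: (decodeStage p.unpair.2).1) else (decodeStage p.unpair.2).1 :
      List ℕ), (decodeStage p.unpair.2).2)) ?_ (.of_computable Computable.id)
    (.oracle_computable (k := fun p => largeQuery (encode
      (p.unpair.1 :: (decodeStage p.unpair.2).1, (decodeStage p.unpair.2).2))) ?_)
  · exact Primrec.to_comp (Primrec.encode.comp (Primrec.pair (Primrec.ite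
      (Primrec.eq.comp Primrec.snd (Primrec.const 0)) (hq.comp Primrec.fst)
      ((Primrec.fst.comp h2).comp Primrec.fst)) ((Primrec.snd.comp h2).comp Primrec.fst)))
  · exact Primrec.to_comp (primrec_largeQuery.comp (Primrec.encode.comp
      (Primrec.pair hq (Primrec.snd.comp h2))))

theorem uniformlyRecursive_nextDigit :
    UniformlyRecursive fun g n => Part.some (nextDigit g (decodeStage n) : ℕ) := by
  have hq (a : Fin 4) : UniformlyRecursive fun g n => Part.some
      (g (largeQuery (encode ((decodeStage n).1, (decodeStage n).2 ++ [a])))) :=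
    .oracle_computable (Primrec.to_comp (primrec_largeQuery.comp (Primrec.encode.comp
      (Primrec.pair (Primrec.fst.comp primrec_decodeStage) (Primrec.list_append.comp
        (Primrec.snd.comp primrec_decodeStage) (Primrec.const [a]))))))
  have hF (a : ℕ) : Computable₂ fun b c : ℕ => if b = 0 then a else c :=
    Primrec.to_comp (Primrec.ite (Primrec.eq.comp Primrec.fst (Primrec.const 0))
      (Primrec.const a) Primrec.snd)
  obtain ⟨c, hc⟩ := UniformlyRecursive.computable₂ (hF 0) (hq 0) (.computable₂ (hF 1) (hq 1)
    (.computable₂ (hF 2) (hq 2) (.of_computable (Computable.const 3))))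
  refine ⟨c, fun g => (hc g).trans ?_⟩
  funext n
  simp only [nextDigit]
  split_ifs <;> rfl

theorem uniformlyRecursive_lowStage :
    UniformlyRecursive fun g n => Part.some (encode (lowStage g n)) := by
  have hF : Computable₂ fun s a : ℕ => encode
      ((decodeStage s).1, (decodeStage s).2 ++ (decode a : Option (Fin 4)).toList) :=
    Primrec.to_comp (Primrec.encode.comp (Primrec.pair
      (Primrec.fst.comp (primrec_decodeStage.comp Primrec.fst))
      (Primrec.list_append.comp (Primrec.snd.comp (primrec_decodeStage.comp Primrec.fst))
        (Primrec.optionToList.comp (Primrec.decode.comp Primrec.snd)))))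
  obtain ⟨c, hc⟩ := UniformlyRecursive.nat_rec (encode (([], []) : List ℕ × List (Fin 4)))
    (.comp_total (.computable₂ hF (.of_computable Computable.id) uniformlyRecursive_nextDigit)
      uniformlyRecursive_avoidStep)
  refine ⟨c, fun g => (hc g).trans ?_⟩
  funext n
  rw [Part.some_inj]
  induction n with
  | zero => rfl
  | succ n ih =>
    simp only at ih ⊢
    rw [ih]
    have hdec (a : Fin 4) : (decode (a : ℕ) : Option (Fin 4)) = some a := by
      rw [show (a : ℕ) = encode a from rfl, encodek]
    simp [lowStage, hdec]

theorem isUniformPathChoice_lowPath : IsUniformPathChoice lowPath := by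
  refine ⟨fun T hT hinf => isPath_lowPath hT hinf, ?_⟩
  obtain ⟨c, hc⟩ := UniformlyRecursive.comp_total uniformlyRecursive_nextDigit
    (.comp_total uniformlyRecursive_avoidStep
      (.computable₂ Primrec₂.natPair.to_comp (.of_computable Computable.id)
        uniformlyRecursive_lowStage))
  refine ⟨c, fun T _ _ => (hc _).trans ?_⟩
  funext n
  simp [pathFun, lowPath]

theorem jump_lowPath_turingReducible {T : Set (List (Fin 4))} (hT : IsTree T)
    (hinf : T.Infinite) : (chi (jump (pathFun (lowPath T))) : ℕ →. ℕ) ≤ᵀ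
      (treeJump T : ℕ →. ℕ) := by
  have hF : Computable₂ fun e s : ℕ => if e ∈ (decodeStage s).1 then 0 else 1 := by
    refine Primrec.to_comp (Primrec.ite ?_ (Primrec.const 0) (Primrec.const 1))
    refine (primrecPred_exists_mem (R := fun b (p : ℕ × ℕ) => b = p.1)
      (Primrec.fst.comp (primrec_decodeStage.comp Primrec.snd))
      (Primrec.eq.comp Primrec.fst (Primrec.fst.comp Primrec.snd))).of_eq fun p => by simp
  refine ((UniformlyRecursive.computable₂ hF (.of_computable Computable.id)
    (.comp_total uniformlyRecursive_lowStage
      (.of_computable Computable.succ))).turingReducible _).of_eq fun e => ?_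
  have := mem_jump_lowPath hT hinf (e := e)
  by_cases h : e ∈ (lowStage (treeJump T) (e + 1)).1 <;> simp [chi, this, h]

/-- A recursive tree is recursive as an oracle. -/
theorem computable_treeOracle {T : Set (List (Fin 4))} (hT : ComputablePred fun σ => σ ∈ T) :
    Computable (treeOracle T) := by
  obtain ⟨_, hc⟩ := hT
  have h : Computable fun n : ℕ => ((decode₂ (List (Fin 4)) n).map fun σ => decide (σ ∈ T)) :=
    Computable.option_map Primrec.decode₂.to_comp (hc.comp Computable.snd)
  have h2 : Computable fun n : ℕ => bif
      ((decode₂ (List (Fin 4)) n).map fun σ => decide (σ ∈ T)).getD false then 1 else 0 :=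
    Computable.cond (Computable.option_getD h (Computable.const false)) (Computable.const 1)
      (Computable.const 0)
  refine h2.of_eq fun n => ?_
  cases hn : decode₂ (List (Fin 4)) n with
  | none =>
    have : ∀ σ ∈ T, encode σ ≠ n := fun σ _ h => by
      rw [← h, encodek₂] at hn
      simp at hn
    simpa [treeOracle, chi] using this
  | some σ =>
    obtain rfl := mem_decode₂.1 hn
    by_cases h : σ ∈ T <;> simp [treeOracle, chi, h]

theorem isLow_lowPath {T : Set (List (Fin 4))} (hT : IsInfiniteRecursiveTree T) :
    IsLow (pathFun (lowPath T)) := by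
  obtain ⟨h1, h2, h3⟩ := hT
  refine (jump_lowPath_turingReducible h1 h2).trans (jump_mono ?_)
  exact (Partrec.recursiveIn (computable_treeOracle h3) :)

theorem IsLow.of_turingReducible {f g : ℕ → ℕ} (hg : IsLow g)
    (h : (f : ℕ →. ℕ) ≤ᵀ (g : ℕ →. ℕ)) : IsLow f :=
  (jump_mono h).trans hg

/-! ### Columns, blocks and levels -/

theorem primrec_pow : Primrec₂ fun a b : ℕ => a ^ b :=
  Primrec₂.unpaired'.1 Nat.Primrec.pow

theorem primrec_log_two : Primrec (Nat.log 2) := by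
  have : Primrec fun y => Nat.findGreatest (fun n => 2 ^ n ≤ y) y :=
    Primrec.nat_findGreatest Primrec.id (Primrec.nat_le.comp
      (primrec_pow.comp (Primrec.const 2) Primrec.snd) Primrec.fst)
  refine this.of_eq fun y => ?_
  rcases Nat.eq_zero_or_pos y with rfl | hy
  · simp
  · refine Nat.findGreatest_eq_iff.2 ⟨Nat.log_le_self 2 y, fun _ => Nat.pow_log_le_self 2 hy.ne',
      fun n hn _ h => ?_⟩
    exact absurd (Nat.le_log_of_pow_le (by norm_num) h) (by omega)

/-- Column `e` of the natural numbers consists of the values `column e y`; they are the numbers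
`x` such that `2 ^ e` is the exact power of `2` that divides `x + 1`. The elements with
`Nat.log 2 y = n` form block `n` of the column. -/
def column (e y : ℕ) : ℕ := 2 ^ e * (2 * y + 1) - 1

theorem column_add_one (e y : ℕ) : column e y + 1 = 2 ^ e * (2 * y + 1) :=
  Nat.sub_add_cancel (Nat.mul_pos (by positivity) (by omega))

theorem column_injective {e e' y y' : ℕ} (h : column e y = column e' y') : e = e' ∧ y = y' := by
  have h2 : 2 ^ e * (2 * y + 1) = 2 ^ e' * (2 * y' + 1) := by
    rw [← column_add_one, ← column_add_one, h]
  have key : ∀ {a b y y' : ℕ}, 2 ^ a * (2 * y + 1) = 2 ^ b * (2 * y' + 1) → a ≤ b → a = b := by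
    intro a b y y' h hab
    obtain ⟨d, rfl⟩ := Nat.exists_eq_add_of_le hab
    rw [pow_add, mul_assoc] at h
    have := Nat.eq_of_mul_eq_mul_left (by positivity) h
    cases d with
    | zero => rfl
    | succ d => rw [pow_succ, mul_right_comm] at this; omega
  have he : e = e' := by
    rcases le_total e e' with hle | hle
    · exact key h2 hle
    · exact (key h2.symm hle).symm
  subst he
  have := Nat.eq_of_mul_eq_mul_left (by positivity) h2
  exact ⟨rfl, by omega⟩

theorem exists_column (x : ℕ) : ∃ e y, column e y = x := by
  obtain ⟨e, m, hm, h⟩ := Nat.exists_eq_two_pow_mul_odd (n := x + 1) (by omega)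
  obtain ⟨y, rfl⟩ := hm
  exact ⟨e, y, by have := column_add_one e y; omega⟩

theorem le_column (e y : ℕ) : e ≤ column e y ∧ y ≤ column e y := by
  have h := column_add_one e y
  have h1 : e < 2 ^ e := Nat.lt_two_pow_self
  constructor <;> nlinarith

theorem primrec_column : Primrec₂ column :=
  Primrec.nat_sub.comp (Primrec.nat_mul.comp (primrec_pow.comp (Primrec.const 2) Primrec.fst)
    (Primrec.succ.comp (Primrec.nat_double.comp Primrec.snd))) (Primrec.const 1)

/-- The stage `p` codes a halting computation of program `e` on an element of block `n` of
column `e`: the input is given by `p.unpair.2` and the number of steps is `p.unpair.1`. -/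
def HaltsAt (e n p : ℕ) : Prop :=
  Nat.log 2 p.unpair.2 = n ∧
    (Code.evaln p.unpair.1 (Denumerable.ofNat Code e) (column e p.unpair.2)).isSome = true

/-- Program `e` has halted on an element of block `n` of column `e` by stage `s`. -/
def HaltedBy (e n s : ℕ) : Prop := ∃ p < s + 1, HaltsAt e n p

/-- The stage `p` is the first one that codes a halting computation of program `e` on an element
of block `n` of column `e`. -/
def FirstHaltsAt (e n p : ℕ) : Prop := HaltsAt e n p ∧ ∀ q < p, ¬ HaltsAt e n q

theorem primrecPred_haltsAt : PrimrecPred fun a : ℕ × ℕ × ℕ => HaltsAt a.1 a.2.1 a.2.2 := by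
  have hp : Primrec fun a : ℕ × ℕ × ℕ => a.2.2.unpair :=
    Primrec.unpair.comp (Primrec.snd.comp Primrec.snd)
  refine PrimrecPred.and (Primrec.eq.comp (primrec_log_two.comp (Primrec.snd.comp hp))
    (Primrec.fst.comp Primrec.snd)) (Primrec.eq.comp (Primrec.option_isSome.comp
    (Code.primrec_evaln.comp (Primrec.pair (Primrec.pair (Primrec.fst.comp hp)
      ((Primrec.ofNat Code).comp Primrec.fst))
      (primrec_column.comp Primrec.fst (Primrec.snd.comp hp))))) (Primrec.const true))

theorem primrecPred_haltedBy : PrimrecPred fun a : ℕ × ℕ × ℕ => HaltedBy a.1 a.2.1 a.2.2 :=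
  primrecPred_exists_lt (R := fun p a => HaltsAt a.1 a.2.1 p)
    (Primrec.succ.comp (Primrec.snd.comp Primrec.snd))
    (primrecPred_haltsAt.comp (Primrec.pair (Primrec.fst.comp Primrec.snd)
      (Primrec.pair (Primrec.fst.comp (Primrec.snd.comp Primrec.snd)) Primrec.fst)))

theorem primrecPred_firstHaltsAt :
    PrimrecPred fun a : ℕ × ℕ × ℕ => FirstHaltsAt a.1 a.2.1 a.2.2 :=
  primrecPred_haltsAt.and (primrecPred_forall_lt (R := fun q a => ¬ HaltsAt a.1 a.2.1 q)
    (Primrec.snd.comp Primrec.snd)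
    (primrecPred_haltsAt.not.comp (Primrec.pair (Primrec.fst.comp Primrec.snd)
      (Primrec.pair (Primrec.fst.comp (Primrec.snd.comp Primrec.snd)) Primrec.fst))))

/-- A computation takes more steps than its input, so a block is halted on only after the stage that
bears its number. -/
theorem HaltsAt.lt {e n p : ℕ} (h : HaltsAt e n p) : n < p := by
  obtain ⟨rfl, h⟩ := h
  obtain ⟨v, hv⟩ := Option.isSome_iff_exists.1 h
  calc Nat.log 2 p.unpair.2 ≤ p.unpair.2 := Nat.log_le_self _ _
    _ ≤ column e p.unpair.2 := (le_column _ _).2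
    _ < p.unpair.1 := Code.evaln_bound hv
    _ ≤ p := Nat.unpair_left_le p

theorem HaltedBy.mono {e n s t : ℕ} (h : HaltedBy e n s) (hst : s ≤ t) : HaltedBy e n t := by
  obtain ⟨p, hp, hh⟩ := h
  exact ⟨p, by omega, hh⟩

theorem HaltsAt.exists_first {e n p : ℕ} (h : HaltsAt e n p) : ∃ q ≤ p, FirstHaltsAt e n q := by
  classical
  exact ⟨Nat.find ⟨p, h⟩, Nat.find_min' _ h, Nat.find_spec ⟨p, h⟩, fun _ hq => Nat.find_min _ hq⟩

theorem FirstHaltsAt.haltedBy_iff {e n p s : ℕ} (h : FirstHaltsAt e n p) :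
    HaltedBy e n s ↔ p ≤ s := by
  constructor
  · rintro ⟨q, hq, hh⟩
    by_contra hlt
    exact h.2 q (by omega) hh
  · exact fun hle => ⟨p, by omega, h.1⟩

theorem FirstHaltsAt.unique {e n p q : ℕ} (hp : FirstHaltsAt e n p) (hq : FirstHaltsAt e n q) :
    p = q :=
  le_antisymm (hp.haltedBy_iff.1 ((hq.haltedBy_iff).2 le_rfl))
    (hq.haltedBy_iff.1 ((hp.haltedBy_iff).2 le_rfl))

open Classical in
/-- The least number that is not the level of an earlier block whose program is still running,
where `l` lists the levels of the earlier blocks. -/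
noncomputable def nextLevel (e : ℕ) (l : List ℕ) : ℕ :=
  (List.range (l.length + 1)).findIdx fun k =>
    decide (∀ m < l.length, l[m]? = some k → HaltedBy e m l.length)

/-- The levels of the first blocks of column `e`. -/
noncomputable def levels (e : ℕ) : ℕ → List ℕ
  | 0 => []
  | n + 1 => levels e n ++ [nextLevel e (levels e n)]

/-- The level of block `n` of column `e`: the number of digits of a path that are to be compared
with the oracles on this block. The levels are assigned greedily, so that at any stage at most one
block of each level is waiting for the program to halt. -/
noncomputable def level (e n : ℕ) : ℕ := nextLevel e (levels e n)

theorem levels_eq (e n : ℕ) : levels e n = (List.range n).map (level e) := by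
  induction n with
  | zero => rfl
  | succ n ih => rw [List.range_succ, List.map_append, ← ih]; rfl

theorem primrec_nextLevel : Primrec₂ nextLevel := by
  classical
  refine Primrec.list_findIdx
    (Primrec.list_range.comp (Primrec.succ.comp (Primrec.list_length.comp Primrec.snd))) ?_
  refine PrimrecPred.decide (p := fun a : (ℕ × List ℕ) × ℕ =>
    ∀ m < a.1.2.length, a.1.2[m]? = some a.2 → HaltedBy a.1.1 m a.1.2.length) ?_
  refine primrecPred_forall_lt (R := fun m (a : (ℕ × List ℕ) × ℕ) =>
    a.1.2[m]? = some a.2 → HaltedBy a.1.1 m a.1.2.length)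
    (Primrec.list_length.comp (Primrec.snd.comp Primrec.fst)) ?_
  have hl : Primrec fun p : ℕ × (ℕ × List ℕ) × ℕ => p.2.1.2 :=
    Primrec.snd.comp (Primrec.fst.comp Primrec.snd)
  refine PrimrecPred.of_eq (PrimrecPred.or (PrimrecPred.not
    (Primrec.eq.comp (Primrec.list_getElem?.comp hl Primrec.fst)
      (Primrec.option_some.comp (Primrec.snd.comp Primrec.snd))))
    (primrecPred_haltedBy.comp (Primrec.pair (Primrec.fst.comp (Primrec.fst.comp Primrec.snd))
      (Primrec.pair Primrec.fst (Primrec.list_length.comp hl))))) fun p => ?_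
  exact (imp_iff_not_or).symm

theorem primrec_level : Primrec₂ level := by
  have h : Primrec₂ levels := by
    have : Primrec₂ fun e n => (Nat.rec [] (fun _ l => l ++ [nextLevel e l]) n : List ℕ) :=
      Primrec.nat_rec (Primrec.const []) (Primrec.list_append.comp
        (Primrec.snd.comp Primrec.snd) (Primrec.list_cons.comp (primrec_nextLevel.comp
          Primrec.fst (Primrec.snd.comp Primrec.snd)) (Primrec.const []))).to₂
    refine this.of_eq fun e n => ?_
    induction n with
    | zero => rfl
    | succ n ih => simp only [levels] at ih ⊢; rw [ih]
  exact primrec_nextLevel.comp Primrec.fst h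

theorem level_eq (e n : ℕ) [DecidablePred fun k => ∀ m < n, level e m = k → HaltedBy e m n] :
    level e n = (List.range (n + 1)).findIdx
      fun k => decide (∀ m < n, level e m = k → HaltedBy e m n) := by
  have h1 : (levels e n).length = n := by simp [levels_eq]
  have h2 {m : ℕ} (hm : m < n) : (levels e n)[m]? = some (level e m) := by simp [levels_eq, hm]
  rw [level, nextLevel, h1]
  congr 1
  funext k
  rw [decide_eq_decide]
  exact forall₂_congr fun m hm => by rw [h2 hm, Option.some_inj]

/-- The level is the least possible one: every smaller number is occupied by a waiting block. -/
theorem exists_waiting_of_lt_level {e n k : ℕ} (hk : k < level e n) :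
    ∃ m < n, level e m = k ∧ ¬ HaltedBy e m n := by
  classical
  rw [level_eq] at hk
  have := List.not_of_lt_findIdx hk
  simpa using this

theorem level_spec (e n : ℕ) :
    level e n ≤ n ∧ ∀ m < n, level e m = level e n → HaltedBy e m n := by
  classical
  induction n using Nat.strong_induction_on with
  | _ n ih =>
    have hlt : level e n < (List.range (n + 1)).length := by
      rw [level_eq]
      refine List.findIdx_lt_length_of_exists ⟨n, by simp, ?_⟩
      simp only [decide_eq_true_eq]
      intro m hm h
      exact absurd (ih m hm).1 (by omega)
    refine ⟨by simpa [Nat.lt_succ_iff] using hlt, ?_⟩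
    rw [level_eq] at hlt
    have := List.findIdx_getElem (w := hlt)
    rw [List.getElem_range, decide_eq_true_eq, ← level_eq] at this
    exact this

/-- Blocks on which the program never halts have different levels. -/
theorem injOn_level (e : ℕ) : Set.InjOn (level e) {n | ∀ p, ¬ HaltsAt e n p} := by
  have key : ∀ {m n : ℕ}, (∀ p, ¬ HaltsAt e m p) → level e m = level e n → ¬ m < n := by
    intro m n hm h hlt
    obtain ⟨p, -, hp⟩ := (level_spec e n).2 m hlt h
    exact hm p hp
  intro m hm n hn h
  exact le_antisymm (not_lt.1 (key hn h.symm)) (not_lt.1 (key hm h))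

/-- If the program halts on almost all blocks, then some level is used infinitely often. -/
theorem exists_infinite_level {e N : ℕ} (hN : ∀ n ≥ N, ∃ p, HaltsAt e n p) :
    ∃ k, {n | level e n = k}.Infinite := by
  by_contra! hfin
  let k := (Finset.range N).sup (level e) + 1
  have hk : ∀ m, level e m = k → ∃ p, HaltsAt e m p := by
    intro m hm
    refine hN m (not_lt.1 fun hlt => ?_)
    have := Finset.le_sup (f := level e) (Finset.mem_range.2 hlt)
    omega
  have hM : ∃ M, ∀ m, level e m = k → HaltedBy e m M := by
    choose! p hp using hk
    obtain ⟨M, hM⟩ := ((hfin k).image p).bddAbove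
    exact ⟨M, fun m hm => ⟨p m, Nat.lt_succ_of_le (hM ⟨m, hm, rfl⟩), hp m hm⟩⟩
  obtain ⟨M, hM⟩ := hM
  have hU : (⋃ j ∈ Finset.range (k + 1), {n | level e n = j}).Finite :=
    (Finset.range (k + 1)).finite_toSet.biUnion fun j _ => hfin j
  obtain ⟨B, hB⟩ := hU.bddAbove
  let n := max M (B + 1)
  have hn : k < level e n := by
    by_contra hle
    have : n ≤ B := hB (Set.mem_biUnion (x := level e n) (by simpa [Nat.lt_succ_iff] using hle) rfl)
    omega
  obtain ⟨m, -, hm, hw⟩ := exists_waiting_of_lt_level hn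
  exact hw ((hM m hm).mono (le_max_left _ _))

/-! ### The tree of a column -/

/-- The approximation to the jump of an oracle that is computed from an initial segment. -/
noncomputable def approxJump (L : List ℕ) : List ℕ :=
  (List.range L.length).map fun i => bif (evalAt L L.length i i).isSome then 1 else 0

/-- The approximation to digit `i` of the path that program `c` computes from the jump of a tree,
computed from an initial segment of the tree. -/
noncomputable def approxDigit (c : OracleCode) (L : List ℕ) (i : ℕ) : Fin 4 :=
  Fin.ofNat 4 ((evalAt (approxJump L) L.length c.index i).getD 0)

/-- The approximate path, with digits replaced by `0` as soon as the path is not seen to stay in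
the tree. -/
noncomputable def approxPath (c : OracleCode) (L : List ℕ) (i : ℕ) : Fin 4 :=
  if L[encode ((List.range (i + 1)).map (approxDigit c L))]? = some 1 then approxDigit c L i else 0

theorem primrec_approxPath (c : OracleCode) : Primrec₂ (approxPath c) := by
  have hJ : Primrec approxJump := by
    refine Primrec.list_map (Primrec.list_range.comp Primrec.list_length) ?_
    exact (Primrec.cond (Primrec.option_isSome.comp (primrec_evalAt.comp (Primrec.pair
      (Primrec.pair Primrec.fst (Primrec.list_length.comp Primrec.fst))
      (Primrec.pair Primrec.snd Primrec.snd)))) (Primrec.const 1) (Primrec.const 0)).to₂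
  have hD : Primrec₂ (approxDigit c) := by
    have h : Primrec fun p : List ℕ × ℕ =>
        (evalAt (approxJump p.1) p.1.length c.index p.2).getD 0 % 4 :=
      Primrec.nat_mod.comp (Primrec.option_getD.comp (primrec_evalAt.comp (Primrec.pair
        (Primrec.pair (hJ.comp Primrec.fst) (Primrec.list_length.comp Primrec.fst))
        (Primrec.pair (Primrec.const _) Primrec.snd))) (Primrec.const 0)) (Primrec.const 4)
    exact Primrec.fin_val_iff.1 h
  refine Primrec.ite (Primrec.eq.comp (Primrec.list_getElem?.comp Primrec.fst
    (Primrec.encode.comp (Primrec.list_map (f := fun p : List ℕ × ℕ => List.range (p.2 + 1))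
      (g := fun p j => approxDigit c p.1 j)
      (Primrec.list_range.comp (Primrec.succ.comp Primrec.snd))
      (hD.comp (Primrec.fst.comp Primrec.fst) Primrec.snd).to₂))) (Primrec.const _))
    hD (Primrec.const 0)

/-- The string `σ` belongs to the tree of column `e`, according to the initial segment `L` of
this tree: on every block on which program `e` is seen to have halted, the string differs from one
of the approximate paths that were current while the block was waiting. -/
def Survives (c : OracleCode) (e : ℕ) (L : List ℕ) (σ : List (Fin 4)) : Prop :=
  ∀ n < σ.length, ∀ p < σ.length, HaltedBy e n p →
    ∃ s < p + 1, n ≤ s ∧ ∃ i < level e n, σ[i]? ≠ some (approxPath c (L.take s) i)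

theorem primrecPred_survives (c : OracleCode) :
    PrimrecPred fun a : (ℕ × List ℕ) × List (Fin 4) => Survives c a.1.1 a.1.2 a.2 := by
  have hlen : Primrec fun a : (ℕ × List ℕ) × List (Fin 4) => a.2.length :=
    Primrec.list_length.comp Primrec.snd
  refine primrecPred_forall_lt (R := fun n (a : (ℕ × List ℕ) × List (Fin 4)) =>
    ∀ p < a.2.length, HaltedBy a.1.1 n p →
      ∃ s < p + 1, n ≤ s ∧ ∃ i < level a.1.1 n, a.2[i]? ≠ some (approxPath c (a.1.2.take s) i))
    hlen ?_
  refine primrecPred_forall_lt (R := fun p (a : ℕ × (ℕ × List ℕ) × List (Fin 4)) =>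
    HaltedBy a.2.1.1 a.1 p → ∃ s < p + 1, a.1 ≤ s ∧
      ∃ i < level a.2.1.1 a.1, a.2.2[i]? ≠ some (approxPath c (a.2.1.2.take s) i))
    (hlen.comp Primrec.snd) ?_
  have he : Primrec fun a : ℕ × (ℕ × List ℕ) × List (Fin 4) => a.2.1.1 :=
    Primrec.fst.comp (Primrec.fst.comp Primrec.snd)
  have h1 : PrimrecPred fun b : ℕ × ℕ × (ℕ × List ℕ) × List (Fin 4) =>
      HaltedBy b.2.2.1.1 b.2.1 b.1 :=
    primrecPred_haltedBy.comp (Primrec.pair (he.comp Primrec.snd)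
      (Primrec.pair (Primrec.fst.comp Primrec.snd) Primrec.fst))
  have h2 : PrimrecPred fun b : ℕ × ℕ × (ℕ × List ℕ) × List (Fin 4) =>
      ∃ s < b.1 + 1, b.2.1 ≤ s ∧ ∃ i < level b.2.2.1.1 b.2.1,
        b.2.2.2[i]? ≠ some (approxPath c (b.2.2.1.2.take s) i) := by
    refine primrecPred_exists_lt (R := fun s (b : ℕ × ℕ × (ℕ × List ℕ) × List (Fin 4)) =>
      b.2.1 ≤ s ∧ ∃ i < level b.2.2.1.1 b.2.1,
        b.2.2.2[i]? ≠ some (approxPath c (b.2.2.1.2.take s) i))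
      (Primrec.succ.comp Primrec.fst) ?_
    refine PrimrecPred.and (Primrec.nat_le.comp (Primrec.fst.comp (Primrec.snd.comp Primrec.snd))
      Primrec.fst) ?_
    refine primrecPred_exists_lt (R := fun i (b : ℕ × ℕ × ℕ × (ℕ × List ℕ) × List (Fin 4)) =>
        b.2.2.2.2[i]? ≠ some (approxPath c (b.2.2.2.1.2.take b.1) i))
      (primrec_level.comp (he.comp (Primrec.snd.comp Primrec.snd))
        (Primrec.fst.comp (Primrec.snd.comp Primrec.snd))) ?_
    have ha : Primrec fun b : ℕ × ℕ × ℕ × ℕ × (ℕ × List ℕ) × List (Fin 4) => b.2.2.2.2 :=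
      Primrec.snd.comp (Primrec.snd.comp (Primrec.snd.comp Primrec.snd))
    exact PrimrecPred.not (Primrec.eq.comp
      (Primrec.list_getElem?.comp (Primrec.snd.comp ha) Primrec.fst)
      (Primrec.option_some.comp ((primrec_approxPath c).comp
        (Primrec.list_take.comp (Primrec.fst.comp Primrec.snd)
          (Primrec.snd.comp (Primrec.fst.comp ha))) Primrec.fst)))
  exact (PrimrecPred.or h1.not h2).of_eq fun b => (imp_iff_not_or).symm

open Classical in
/-- The characteristic function of the tree of column `e`, as a list of its first values. -/
noncomputable def treeSegment (c : OracleCode) (e : ℕ) : ℕ → List ℕ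
  | 0 => []
  | s + 1 => treeSegment c e s ++
      [if ∃ σ ∈ (decode₂ (List (Fin 4)) s).toList, Survives c e (treeSegment c e s) σ then 1 else 0]

theorem primrec_treeSegment (c : OracleCode) : Primrec₂ (treeSegment c) := by
  classical
  have : Primrec₂ fun e s => (Nat.rec [] (fun s L => L ++
      [if ∃ σ ∈ (decode₂ (List (Fin 4)) s).toList, Survives c e L σ then 1 else 0]) s :
      List ℕ) := by
    have hc : PrimrecPred fun a : ℕ × ℕ × List ℕ =>
        ∃ σ ∈ (decode₂ (List (Fin 4)) a.2.1).toList, Survives c a.1 a.2.2 σ := ?_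
    · exact Primrec.nat_rec (Primrec.const []) (Primrec.list_append.comp
        (Primrec.snd.comp Primrec.snd) (Primrec.list_cons.comp (Primrec.ite hc (Primrec.const 1)
          (Primrec.const 0)) (Primrec.const []))).to₂
    refine primrecPred_exists_mem (R := fun σ (a : ℕ × ℕ × List ℕ) => Survives c a.1 a.2.2 σ)
      (Primrec.optionToList.comp (Primrec.decode₂.comp (Primrec.fst.comp Primrec.snd))) ?_
    exact (primrecPred_survives c).comp (Primrec.pair (Primrec.pair
      (Primrec.fst.comp Primrec.snd) (Primrec.snd.comp (Primrec.snd.comp Primrec.snd)))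
      Primrec.fst)
  refine this.of_eq fun e n => ?_
  induction n with
  | zero => rfl
  | succ n ih => simp only [treeSegment] at ih ⊢; rw [ih]

/-- The approximate path of column `e` at stage `s`. -/
noncomputable def stagePath (c : OracleCode) (e s : ℕ) : ℕ → Fin 4 :=
  approxPath c (treeSegment c e s)

/-- The tree of column `e`: all strings that avoid the boxes on which the diagonalization against
program `e` takes place. -/
def columnTree (c : OracleCode) (e : ℕ) : Set (List (Fin 4)) :=
  {σ | ∀ n < σ.length, ∀ p < σ.length, HaltedBy e n p →
    ∃ s < p + 1, n ≤ s ∧ ∃ i < level e n, σ[i]? ≠ some (stagePath c e s i)}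

theorem length_le_encode (σ : List (Fin 4)) : σ.length ≤ encode σ := by
  induction σ with
  | nil => simp
  | cons a σ ih =>
    rw [List.length_cons, Encodable.encode_list_cons]
    exact Nat.succ_le_succ (ih.trans (Nat.right_le_pair _ _))

/-- Later stages do not change the part of the tree that is already decided. -/
theorem treeSegment_take (c : OracleCode) (e : ℕ) {s t : ℕ} (h : s ≤ t) :
    (treeSegment c e t).take s = treeSegment c e s := by
  have hlen : ∀ t, (treeSegment c e t).length = t := fun t => by
    induction t with
    | zero => rfl
    | succ t ih => simp [treeSegment, ih]
  induction t, h using Nat.le_induction with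
  | base => rw [List.take_of_length_le (hlen s).le]
  | succ t hst ih => rw [treeSegment, List.take_append_of_le_length (by rw [hlen]; exact hst), ih]

theorem survives_treeSegment {c : OracleCode} {e t : ℕ} {σ : List (Fin 4)} (h : σ.length ≤ t) :
    Survives c e (treeSegment c e t) σ ↔ σ ∈ columnTree c e := by
  refine forall₄_congr fun n _ p hp => forall_congr' fun _ => exists_congr fun s => ?_
  refine and_congr_right fun hs => ?_
  rw [treeSegment_take c e (by omega), stagePath]

theorem treeSegment_eq (c : OracleCode) (e s : ℕ) :
    treeSegment c e s = restrict (treeOracle (columnTree c e)) s := by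
  classical
  induction s with
  | zero => rfl
  | succ s ih =>
    have hiff : (∃ σ ∈ (decode₂ (List (Fin 4)) s).toList,
        Survives c e (treeSegment c e s) σ) ↔ s ∈ encode '' columnTree c e := by
      constructor
      · rintro ⟨σ, hσ, h⟩
        have hs : encode σ = s := mem_decode₂.1 (by simpa using hσ)
        exact ⟨σ, (survives_treeSegment (hs ▸ length_le_encode σ)).1 h, hs⟩
      · rintro ⟨σ, hσ, rfl⟩
        exact ⟨σ, by simp, (survives_treeSegment (length_le_encode σ)).2 hσ⟩
    rw [treeSegment, if_congr hiff rfl rfl, ih]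
    simp [restrict, List.range_succ, treeOracle, chi]

theorem isTree_columnTree (c : OracleCode) (e : ℕ) : IsTree (columnTree c e) := by
  intro σ τ hτ hσ n hn p hp hh
  obtain ⟨s, hs, hns, i, hi, hne⟩ :=
    hσ n (hn.trans_le hτ.length_le) p (hp.trans_le hτ.length_le) hh
  refine ⟨s, hs, hns, i, hi, ?_⟩
  have hlt : i < τ.length := (hi.trans_le (level_spec e n).1).trans hn
  obtain ⟨ρ, rfl⟩ := hτ
  rwa [List.getElem?_append_left hlt] at hne

theorem computablePred_columnTree (c : OracleCode) (e : ℕ) :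
    ComputablePred fun σ => σ ∈ columnTree c e := by
  have h : PrimrecPred fun σ : List (Fin 4) => Survives c e (treeSegment c e σ.length) σ :=
    (primrecPred_survives c).comp (Primrec.pair (Primrec.pair (Primrec.const e)
      ((primrec_treeSegment c).comp (Primrec.const e) Primrec.list_length)) Primrec.id)
  obtain ⟨_, h⟩ := h.of_eq fun σ => survives_treeSegment le_rfl
  exact ⟨_, h.to_comp⟩

/-- If the tree of column `e` is infinite, the approximate paths converge to the path that is
computed from the jump of the tree. -/
theorem eventually_stagePath {c : OracleCode} {e : ℕ} {f : ℕ → Fin 4}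
    (hf : c.eval (chi (jump (treeOracle (columnTree c e)))) = (pathFun f : ℕ →. ℕ))
    (hpath : IsPath f (columnTree c e)) (i : ℕ) :
    ∀ᶠ s in Filter.atTop, stagePath c e s i = f i := by
  set g := treeOracle (columnTree c e) with hg
  have hJ : ∀ t, ∀ᶠ s in Filter.atTop,
      (approxJump (restrict g s)).take t = restrict (chi (jump g)) t := by
    intro t
    have hbit : ∀ j, ∀ᶠ s in Filter.atTop,
        (bif (evalAt (restrict g s) s j j).isSome then 1 else 0) = chi (jump g) j := by
      intro j
      by_cases hj : j ∈ jump g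
      · obtain ⟨v, hv⟩ := Part.dom_iff_mem.1 (mem_jump_iff.1 hj)
        filter_upwards [eventually_evalAt (eventually_take_restrict g) hv] with s hs
        simp [hs, chi, hj]
      · refine Filter.Eventually.of_forall fun s => ?_
        have : evalAt (restrict g s) s j j = none := by
          by_contra h
          obtain ⟨v, hv⟩ := Option.ne_none_iff_exists'.1 h
          exact hj (mem_jump_iff.2 (Part.dom_iff_mem.2 ⟨v, evalAt_sound le_rfl hv⟩))
        simp [this, chi, hj]
    filter_upwards [(Filter.eventually_all_finset (Finset.range t)).2 fun j _ => hbit j,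
      Filter.eventually_ge_atTop t] with s hs hst
    rw [approxJump, length_restrict, restrict, restrict, ← List.map_take, List.take_range,
      Nat.min_eq_left hst]
    exact List.map_congr_left fun j hj => hs j (by simpa using hj)
  have hD : ∀ j, ∀ᶠ s in Filter.atTop, approxDigit c (restrict g s) j = f j := by
    intro j
    have hv : (f j : ℕ) ∈ (ofIndex c.index).eval (chi (jump g)) j := by
      rw [ofIndex_index, hf]
      simp [pathFun]
    filter_upwards [eventually_evalAt hJ hv] with s hs
    simp [approxDigit, hs]
  filter_upwards [(Filter.eventually_all_finset (Finset.range (i + 1))).2 fun j _ => hD j,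
    Filter.eventually_gt_atTop (encode ((List.range (i + 1)).map f))] with s hs hlt
  have hmap : (List.range (i + 1)).map (approxDigit c (restrict g s)) =
      (List.range (i + 1)).map f :=
    List.map_congr_left fun j hj => hs j (by simpa using hj)
  have hmem : g (encode ((List.range (i + 1)).map f)) = 1 := by
    simpa [hg, treeOracle, chi] using hpath (i + 1)
  rw [stagePath, treeSegment_eq, ← hg, approxPath, hmap, getElem?_restrict hlt, hmem, if_pos rfl]
  exact hs i (by simp)

/-- If the tree of column `e` is finite, the approximate paths vanish from some digit on. -/
theorem stagePath_eq_zero {c : OracleCode} {e : ℕ} (hfin : (columnTree c e).Finite) :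
    ∃ N, ∀ i ≥ N, ∀ s, stagePath c e s i = 0 := by
  obtain ⟨N, hN⟩ := (hfin.image List.length).bddAbove
  refine ⟨N, fun i hi s => ?_⟩
  rw [stagePath, treeSegment_eq, approxPath, if_neg]
  intro h
  have hlt := (List.getElem?_eq_some_iff.1 h).1
  rw [length_restrict] at hlt
  rw [getElem?_restrict hlt, Option.some_inj] at h
  have hmem : (List.range (i + 1)).map (approxDigit c (restrict (treeOracle (columnTree c e)) s)) ∈
      columnTree c e := by
    by_contra hno
    rw [treeOracle_encode.2 hno] at h
    exact zero_ne_one h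
  have := hN ⟨_, hmem, rfl⟩
  simp at this
  omega

/-! ### Density -/

section Density

open Filter

theorem ncard_column_le {E : Set ℕ} {e N : ℕ} (hN : ∀ y y', N ≤ Nat.log 2 y →
    Nat.log 2 y = Nat.log 2 y' → column e y ∈ E → column e y' ∈ E → y = y') (n : ℕ) :
    {y | column e y ∈ E ∧ column e y < n}.ncard ≤ 2 ^ N + (Nat.log 2 n + 1) := by
  have hsub : {y | column e y ∈ E ∧ column e y < n} ⊆ ↑(Finset.range (2 ^ N)) ∪
      {y | N ≤ Nat.log 2 y ∧ column e y ∈ E ∧ y ≤ n} := by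
    rintro y ⟨hy, hlt⟩
    by_cases h : y < 2 ^ N
    · exact Or.inl (by simpa using h)
    · exact Or.inr ⟨Nat.le_log_of_pow_le (by norm_num) (not_lt.1 h), hy,
        (le_column e y).2.trans hlt.le⟩
  have hfin : {y | N ≤ Nat.log 2 y ∧ column e y ∈ E ∧ y ≤ n}.Finite :=
    (Set.finite_Iic n).subset fun y hy => hy.2.2
  have hcard : {y | N ≤ Nat.log 2 y ∧ column e y ∈ E ∧ y ≤ n}.ncard ≤ Nat.log 2 n + 1 := by
    have := Set.ncard_le_ncard_of_injOn (t := ↑(Finset.range (Nat.log 2 n + 1))) (Nat.log 2)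
      (fun y (hy : y ∈ {y | N ≤ Nat.log 2 y ∧ column e y ∈ E ∧ y ≤ n}) => by
        simpa [Nat.lt_succ_iff] using Nat.log_mono_right hy.2.2)
      (fun y hy y' hy' h => hN y y' hy.1 h hy.2.1 hy'.2.1) (Finset.finite_toSet _)
    rwa [Set.ncard_coe_finset, Finset.card_range] at this
  calc _ ≤ _ := Set.ncard_le_ncard hsub ((Finset.finite_toSet _).union hfin)
    _ ≤ _ := Set.ncard_union_le _ _
    _ ≤ _ := by
      rw [Set.ncard_coe_finset, Finset.card_range]
      exact Nat.add_le_add_left hcard _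

/-- The columns with index at least `M` together have density at most `2⁻ᴹ`, so a set that is
small in every column is small. -/
theorem ncard_inter_Iio_le {E : Set ℕ} {N : ℕ → ℕ} (hN : ∀ e y y', N e ≤ Nat.log 2 y →
    Nat.log 2 y = Nat.log 2 y' → column e y ∈ E → column e y' ∈ E → y = y') (M n : ℕ) :
    (E ∩ Set.Iio n).ncard ≤
      ∑ e ∈ Finset.range M, (2 ^ N e + (Nat.log 2 n + 1)) + (n / 2 ^ M + 1) := by
  have hsub : E ∩ Set.Iio n ⊆ (⋃ e ∈ Finset.range M,
      column e '' {y | column e y ∈ E ∧ column e y < n}) ∪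
      {x | x < n ∧ 2 ^ M ∣ x + 1} := by
    rintro x ⟨hx, hlt⟩
    obtain ⟨e, y, rfl⟩ := exists_column x
    by_cases he : e < M
    · exact Or.inl (Set.mem_biUnion (x := e) (by simpa using he) ⟨y, ⟨hx, hlt⟩, rfl⟩)
    · refine Or.inr ⟨hlt, ?_⟩
      rw [column_add_one]
      exact (pow_dvd_pow 2 (not_lt.1 he)).mul_right _
  have hfin (e : ℕ) : (column e '' {y | column e y ∈ E ∧ column e y < n}).Finite :=
    (Set.finite_Iio n).subset (by rintro _ ⟨y, hy, rfl⟩; exact hy.2)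
  have hcard : {x | x < n ∧ 2 ^ M ∣ x + 1}.ncard ≤ n / 2 ^ M + 1 := by
    have := Set.ncard_le_ncard_of_injOn (t := ↑(Finset.range (n / 2 ^ M + 1)))
      (fun x => (x + 1) / 2 ^ M)
      (fun x (hx : x ∈ {x | x < n ∧ 2 ^ M ∣ x + 1}) => by
        simpa [Nat.lt_succ_iff] using Nat.div_le_div_right (Nat.succ_le_of_lt hx.1))
      (fun x hx y hy h => by
        have h1 := Nat.div_mul_cancel hx.2
        have h2 := Nat.div_mul_cancel hy.2
        simp only at h
        rw [h] at h1
        omega) (Finset.finite_toSet _)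
    rwa [Set.ncard_coe_finset, Finset.card_range] at this
  calc _ ≤ _ := Set.ncard_le_ncard hsub (Set.Finite.union
        ((Finset.finite_toSet _).biUnion fun e _ => hfin e)
        ((Set.finite_Iio n).subset fun x hx => hx.1))
    _ ≤ _ := Set.ncard_union_le _ _
    _ ≤ _ := Nat.add_le_add ((Finset.set_ncard_biUnion_le _ _).trans
        (Finset.sum_le_sum fun e _ => (Set.ncard_image_le ((Set.finite_Iio n).subset
          fun y hy => (le_column e y).2.trans_lt hy.2)).trans (ncard_column_le (hN e) n))) hcard

theorem tendsto_natLog_div : Tendsto (fun n : ℕ => (Nat.log 2 n : ℝ) / n) atTop (nhds 0) := by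
  have h : Tendsto (fun n : ℕ => Real.log n / n / Real.log 2) atTop (nhds 0) := by
    have := (Real.isLittleO_log_id_atTop.tendsto_div_nhds_zero.comp
      tendsto_natCast_atTop_atTop).div_const (Real.log 2)
    simpa using this
  refine squeeze_zero (fun n => by positivity) (fun n => ?_) h
  rw [div_right_comm]
  gcongr
  exact Real.natLog_le_logb n 2

/-- A set has density one if in every column its complement has at most one element in almost
every block. -/
theorem hasDensityOne_of_column {D : Set ℕ} (h : ∀ e, ∃ N, ∀ y y', N ≤ Nat.log 2 y →
    Nat.log 2 y = Nat.log 2 y' → column e y ∉ D → column e y' ∉ D → y = y') :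
    HasDensityOne D := by
  choose N hN using h
  have hsplit (n : ℕ) : (D ∩ Set.Iio n).ncard + (Dᶜ ∩ Set.Iio n).ncard = n := by
    rw [← Set.ncard_union_eq (by
      rw [Set.disjoint_left]; exact fun x hx hx' => hx'.1 hx.1)
      ((Set.finite_Iio n).subset Set.inter_subset_right)
      ((Set.finite_Iio n).subset Set.inter_subset_right), ← Set.union_inter_distrib_right,
      Set.union_compl_self, Set.univ_inter, ← Finset.coe_Iio, Set.ncard_coe_finset, Nat.card_Iio]
  have hzero : Tendsto (fun n : ℕ => ((Dᶜ ∩ Set.Iio n).ncard : ℝ) / n) atTop (nhds 0) := by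
    rw [Metric.tendsto_atTop']
    intro ε hε
    obtain ⟨M, hM⟩ := exists_pow_lt_of_lt_one (half_pos hε) (by norm_num : (1 / 2 : ℝ) < 1)
    let S : ℝ := ∑ e ∈ Finset.range M, (2 ^ N e + 1 : ℝ) + 1
    have hlim : Tendsto (fun n : ℕ => S / n + M * ((Nat.log 2 n : ℝ) / n)) atTop (nhds 0) := by
      simpa using (tendsto_const_div_atTop_nhds_zero_nat S).add
        (tendsto_natLog_div.const_mul (M : ℝ))
    obtain ⟨n₀, hn₀⟩ := eventually_atTop.1 (hlim.eventually (gt_mem_nhds (half_pos hε)))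
    refine ⟨n₀ + 1, fun n hn => ?_⟩
    have hn0 : (0 : ℝ) < n := by exact_mod_cast (by omega : 0 < n)
    rw [Real.dist_eq, sub_zero, abs_of_nonneg (by positivity)]
    have hc : ((Dᶜ ∩ Set.Iio n).ncard : ℝ) ≤ S + M * Nat.log 2 n + n * (1 / 2) ^ M := by
      have h1 : ((Dᶜ ∩ Set.Iio n).ncard : ℝ) ≤
          ((∑ e ∈ Finset.range M, (2 ^ N e + (Nat.log 2 n + 1)) + (n / 2 ^ M + 1) : ℕ) : ℝ) := by
        exact_mod_cast ncard_inter_Iio_le (E := Dᶜ) hN M n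
      refine h1.trans ?_
      have h2 : ((n / 2 ^ M : ℕ) : ℝ) ≤ n * (1 / 2) ^ M := by
        refine Nat.cast_div_le.trans (le_of_eq ?_)
        push_cast
        rw [one_div, inv_pow, div_eq_mul_inv]
      push_cast
      simp only [S, Finset.sum_add_distrib, Finset.sum_const, Finset.card_range, nsmul_eq_mul]
      linarith
    calc ((Dᶜ ∩ Set.Iio n).ncard : ℝ) / n
        ≤ (S + M * Nat.log 2 n + n * (1 / 2) ^ M) / n := by gcongr
      _ = (S / n + M * ((Nat.log 2 n : ℝ) / n)) + (1 / 2) ^ M := by field_simp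
      _ < ε / 2 + ε / 2 := add_lt_add (hn₀ n (by omega)) hM
      _ = ε := add_halves ε
  have := hzero.const_sub 1
  rw [sub_zero] at this
  refine this.congr' ?_
  filter_upwards [eventually_gt_atTop 0] with n hn
  have h0 : (n : ℝ) ≠ 0 := by exact_mod_cast hn.ne'
  have h1 : ((D ∩ Set.Iio n).ncard : ℝ) + (Dᶜ ∩ Set.Iio n).ncard = n := by exact_mod_cast hsplit n
  rw [← div_self h0, ← sub_div]
  congr 1
  linarith

/-- A set of density one meets almost every block of every column. -/
theorem HasDensityOne.exists_block {D : Set ℕ} (hD : HasDensityOne D) (e : ℕ) :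
    ∃ N, ∀ n ≥ N, ∃ y, Nat.log 2 y = n ∧ column e y ∈ D := by
  let δ : ℝ := 1 / 2 ^ (e + 2)
  have hδ : 0 < δ := by positivity
  obtain ⟨n₀, hn₀⟩ := eventually_atTop.1 (hD.eventually (lt_mem_nhds (sub_lt_self 1 hδ)))
  refine ⟨n₀ + 1, fun n hn => ?_⟩
  by_contra! hno
  let m := 2 ^ (e + n + 2)
  have hm : n₀ ≤ m := by
    have : e + n + 2 < m := Nat.lt_two_pow_self
    omega
  have hlt := hn₀ m hm
  -- the block has `2 ^ n` elements, all of them below `m`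
  have hinj : Function.Injective (column e) := fun y y' h => (column_injective h).2
  let B : Finset ℕ := (Finset.Ico (2 ^ n) (2 ^ (n + 1))).image (column e)
  have hB : B.card = 2 ^ n := by
    rw [Finset.card_image_of_injective _ hinj, Nat.card_Ico, pow_succ]
    omega
  have hsub : D ∩ Set.Iio m ⊆ ↑(Finset.range m \ B) := by
    rintro x ⟨hx, hxm⟩
    simp only [Finset.coe_sdiff, Finset.coe_range, Set.mem_sdiff, Finset.mem_coe]
    refine ⟨hxm, fun hxB => ?_⟩
    obtain ⟨y, hy, rfl⟩ := Finset.mem_image.1 hxB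
    rw [Finset.mem_Ico] at hy
    exact hno y (Nat.log_eq_of_pow_le_of_lt_pow hy.1 hy.2) hx
  have hBsub : B ⊆ Finset.range m := by
    intro x hx
    obtain ⟨y, hy, rfl⟩ := Finset.mem_image.1 hx
    rw [Finset.mem_Ico] at hy
    have h1 := column_add_one e y
    have h2 : 2 ^ e * (2 * y + 1) ≤ m := by
      calc 2 ^ e * (2 * y + 1) ≤ 2 ^ e * (2 * 2 ^ (n + 1)) := by
            apply Nat.mul_le_mul_left; omega
        _ = m := by simp only [m]; ring
    rw [Finset.mem_range]
    omega
  have hcard : (D ∩ Set.Iio m).ncard + 2 ^ n ≤ m := by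
    have h1 := Set.ncard_le_ncard hsub (Finset.finite_toSet _)
    rw [Set.ncard_coe_finset, Finset.card_sdiff_of_subset hBsub, hB, Finset.card_range] at h1
    have h2 : 2 ^ n ≤ m := Nat.pow_le_pow_right (by norm_num) (by omega)
    omega
  have hm0 : (0 : ℝ) < m := by positivity
  have hreal : ((D ∩ Set.Iio m).ncard : ℝ) + 2 ^ n ≤ m := by exact_mod_cast hcard
  have hδm : δ * m = 2 ^ n := by
    simp only [δ, m]
    push_cast
    rw [show e + n + 2 = (e + 2) + n by omega, pow_add]
    field_simp
    ring
  rw [lt_div_iff₀ hm0, sub_mul, hδm] at hlt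
  linarith

end Density

/-! ### The diagonal set -/

theorem chi_eq_zero_or_one (A : Set ℕ) (n : ℕ) : chi A n = 0 ∨ chi A n = 1 := by
  by_cases h : n ∈ A <;> simp [chi, h]

/-- On block `n` of column `e` the approximate paths of the stages from `n` to `p`, seen through
`π`, agree with `A` on the digits below the level of the block. -/
def AgreesUntil (c : OracleCode) (π : Fin 4 → ℕ) (A : Set ℕ) (e n p : ℕ) : Prop :=
  ∀ s, n ≤ s → s ≤ p → ∀ i < level e n, π (stagePath c e s i) = chi A i

/-- A finite part `L` of the oracle suffices to see that `column e y` is not used for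
diagonalization: either another element of the block was the first to receive an answer, or the
oracle disagrees with an approximate path while the block is waiting. -/
def Resolved (c : OracleCode) (π : Fin 4 → ℕ) (L : List ℕ) (e y : ℕ) : Prop :=
  (∃ p < L.length, FirstHaltsAt e (Nat.log 2 y) p ∧ p.unpair.2 ≠ y) ∨
    ∃ s < L.length, Nat.log 2 y ≤ s ∧ ¬ HaltedBy e (Nat.log 2 y) s ∧
      ∃ i < level e (Nat.log 2 y), L[i]? ≠ some (π (stagePath c e s i))

theorem primrecPred_resolved (c : OracleCode) (π : Fin 4 → ℕ) :
    PrimrecPred fun a : List ℕ × ℕ × ℕ => Resolved c π a.1 a.2.1 a.2.2 := by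
  have hn : Primrec fun a : List ℕ × ℕ × ℕ => Nat.log 2 a.2.2 :=
    primrec_log_two.comp (Primrec.snd.comp Primrec.snd)
  have he : Primrec fun a : List ℕ × ℕ × ℕ => a.2.1 := Primrec.fst.comp Primrec.snd
  have hl : Primrec fun a : List ℕ × ℕ × ℕ => a.1.length := Primrec.list_length.comp Primrec.fst
  refine PrimrecPred.or (primrecPred_exists_lt (R := fun p (a : List ℕ × ℕ × ℕ) =>
    FirstHaltsAt a.2.1 (Nat.log 2 a.2.2) p ∧ p.unpair.2 ≠ a.2.2) hl ?_)
    (primrecPred_exists_lt (R := fun s (a : List ℕ × ℕ × ℕ) =>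
      Nat.log 2 a.2.2 ≤ s ∧ ¬ HaltedBy a.2.1 (Nat.log 2 a.2.2) s ∧
        ∃ i < level a.2.1 (Nat.log 2 a.2.2), a.1[i]? ≠ some (π (stagePath c a.2.1 s i))) hl ?_)
  · exact PrimrecPred.and (primrecPred_firstHaltsAt.comp (Primrec.pair (he.comp Primrec.snd)
      (Primrec.pair (hn.comp Primrec.snd) Primrec.fst)))
      (PrimrecPred.not (Primrec.eq.comp (Primrec.snd.comp (Primrec.unpair.comp Primrec.fst))
        (Primrec.snd.comp (Primrec.snd.comp Primrec.snd))))
  · refine PrimrecPred.and (Primrec.nat_le.comp (hn.comp Primrec.snd) Primrec.fst)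
      (PrimrecPred.and (PrimrecPred.not (primrecPred_haltedBy.comp (Primrec.pair
        (he.comp Primrec.snd) (Primrec.pair (hn.comp Primrec.snd) Primrec.fst)))) ?_)
    refine primrecPred_exists_lt (R := fun i (b : ℕ × List ℕ × ℕ × ℕ) =>
      b.2.1[i]? ≠ some (π (stagePath c b.2.2.1 b.1 i)))
      (primrec_level.comp (he.comp Primrec.snd) (hn.comp Primrec.snd)) ?_
    have ha : Primrec fun b : ℕ × ℕ × List ℕ × ℕ × ℕ => b.2.2 := Primrec.snd.comp Primrec.snd
    exact PrimrecPred.not (Primrec.eq.comp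
      (Primrec.list_getElem?.comp (Primrec.fst.comp ha) Primrec.fst)
      (Primrec.option_some.comp ((Primrec.dom_finite π).comp ((primrec_approxPath c).comp
        ((primrec_treeSegment c).comp (he.comp ha) (Primrec.fst.comp Primrec.snd))
        Primrec.fst))))

open Classical in
/-- The search for a finite part of the oracle that settles `x` negatively. -/
noncomputable def negativeAnswer (c : OracleCode) (π : Fin 4 → ℕ) (L : List ℕ) (x : ℕ) :
    Option ℕ :=
  if ∃ e < x + 1, ∃ y < x + 1, column e y = x ∧ Resolved c π L e y then some 0 else none

theorem computable_negativeAnswer (c : OracleCode) (π : Fin 4 → ℕ) :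
    Computable₂ (negativeAnswer c π) := by
  classical
  refine Primrec.to_comp (Primrec.ite ?_ (Primrec.const _) (Primrec.const _))
  have hx : Primrec fun a : List ℕ × ℕ => a.2 + 1 := Primrec.succ.comp Primrec.snd
  refine primrecPred_exists_lt (R := fun e (a : List ℕ × ℕ) =>
    ∃ y < a.2 + 1, column e y = a.2 ∧ Resolved c π a.1 e y) hx ?_
  refine primrecPred_exists_lt (R := fun y (b : ℕ × List ℕ × ℕ) =>
    column b.1 y = b.2.2 ∧ Resolved c π b.2.1 b.1 y) (hx.comp Primrec.snd) ?_
  have he : Primrec fun b : ℕ × ℕ × List ℕ × ℕ => b.2.1 := Primrec.fst.comp Primrec.snd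
  exact PrimrecPred.and (Primrec.eq.comp (primrec_column.comp he Primrec.fst)
    (Primrec.snd.comp (Primrec.snd.comp Primrec.snd)))
    ((primrecPred_resolved c π).comp (Primrec.pair
      (Primrec.fst.comp (Primrec.snd.comp Primrec.snd)) (Primrec.pair he Primrec.fst)))

/-- The generic description that only gives the negative answers it is certain of. -/
noncomputable def negativeDescription (c : OracleCode) (π : Fin 4 → ℕ) (A : Set ℕ) : ℕ →. Bool :=
  fun x => (Nat.rfindOpt fun s => negativeAnswer c π (restrict (chi A) s) x).map fun _ => false

theorem recursiveIn_negativeDescription (c : OracleCode) (π : Fin 4 → ℕ) (A : Set ℕ) :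
    RecursiveIn {(chi A : ℕ →. ℕ)} (negativeDescription c π A) := by
  have h := RecursiveIn.iff_nat.1
    ((UniformlyRecursive.search (computable_negativeAnswer c π)).turingReducible (chi A))
  refine h.of_eq fun x => ?_
  ext v
  simp only [negativeDescription, decode_nat, Part.coe_some, Part.bind_some, Part.map_map,
    Part.mem_map_iff]
  have hv : ∀ w ∈ Nat.rfindOpt fun s => negativeAnswer c π (restrict (chi A) s) x, w = 0 := by
    intro w hw
    obtain ⟨s, hs⟩ := Nat.rfindOpt_spec hw
    unfold negativeAnswer at hs
    split_ifs at hs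
    · simpa [eq_comm] using hs
    · simp at hs
  constructor
  · exact fun hw => ⟨v, hw, (hv v hw).symm⟩
  · rintro ⟨w, hw, rfl⟩
    have := hv w hw
    subst this
    exact hw

theorem mem_dom_negativeDescription {c : OracleCode} {π : Fin 4 → ℕ} {A : Set ℕ} {e y : ℕ} :
    column e y ∈ (negativeDescription c π A).Dom ↔ ∃ s, Resolved c π (restrict (chi A) s) e y := by
  rw [PFun.mem_dom]
  simp only [negativeDescription, Part.mem_map_iff]
  constructor
  · rintro ⟨_, v, hv, -⟩
    obtain ⟨s, hs⟩ := Nat.rfindOpt_spec hv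
    unfold negativeAnswer at hs
    split_ifs at hs with h
    · obtain ⟨e', _, y', _, h, hr⟩ := h
      obtain ⟨rfl, rfl⟩ := column_injective h
      exact ⟨s, hr⟩
    · simp at hs
  · rintro ⟨s, hs⟩
    have : (Nat.rfindOpt fun s => negativeAnswer c π (restrict (chi A) s) (column e y)).Dom := by
      refine Nat.rfindOpt_dom.2 ⟨s, 0, ?_⟩
      rw [negativeAnswer, if_pos ⟨e, Nat.lt_succ_of_le (le_column e y).1, y,
        Nat.lt_succ_of_le (le_column e y).2, rfl, hs⟩]
      rfl
    exact ⟨false, _, Part.get_mem this, rfl⟩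

theorem eq_false_of_mem_negativeDescription {c : OracleCode} {π : Fin 4 → ℕ} {A : Set ℕ} {x : ℕ}
    {b : Bool} (h : b ∈ negativeDescription c π A x) : b = false := by
  obtain ⟨_, _, h⟩ := (Part.mem_map_iff _).1 h
  exact h.symm

/-- If every element of `C` requires agreement of `A` with the approximate paths, and this agreement
lasts forever on only finitely many of the blocks that wait forever in each column, then `C` is
generically `A`-computable: the description misses the elements of these blocks and at most one
element of every other block. -/
theorem genericallyComputableIn_of_agreesUntil {c : OracleCode} {π : Fin 4 → ℕ} {A C : Set ℕ}
    (hC : ∀ x ∈ C, ∃ e y p, column e y = x ∧ FirstHaltsAt e (Nat.log 2 y) p ∧ p.unpair.2 = y ∧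
      AgreesUntil c π A e (Nat.log 2 y) p)
    (hfin : ∀ e, {n | (∀ p, ¬ HaltsAt e n p) ∧ ∀ p, AgreesUntil c π A e n p}.Finite) :
    GenericallyComputableIn A C := by
  refine ⟨negativeDescription c π A, recursiveIn_negativeDescription c π A, ?_, fun x => ⟨?_, ?_⟩⟩
  · refine hasDensityOne_of_column fun e => ?_
    obtain ⟨N, hN⟩ := (hfin e).bddAbove
    refine ⟨N + 1, fun y y' hy hyy' hm hm' => ?_⟩
    rw [mem_dom_negativeDescription, not_exists] at hm hm'
    by_cases hh : ∃ p, HaltsAt e (Nat.log 2 y) p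
    · obtain ⟨p, hp⟩ := hh
      obtain ⟨q, -, hq⟩ := hp.exists_first
      have h1 : q.unpair.2 = y := by
        by_contra hne
        exact hm (q + 1) (Or.inl ⟨q, by simp, hq, hne⟩)
      have h2 : q.unpair.2 = y' := by
        by_contra hne
        exact hm' (q + 1) (Or.inl ⟨q, by simp, hyy' ▸ hq, hne⟩)
      exact h1.symm.trans h2
    · push Not at hh
      have hnot : ¬ ∀ p, AgreesUntil c π A e (Nat.log 2 y) p := by
        intro h
        have : Nat.log 2 y ≤ N := hN ⟨hh, h⟩
        omega
      simp only [AgreesUntil, not_forall] at hnot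
      obtain ⟨p, s, hs, hsp, i, hi, hne⟩ := hnot
      refine absurd (Or.inr ⟨s, by simp, hs, ?_, i, hi, ?_⟩) (hm (s + 1))
      · rintro ⟨q, -, hq⟩
        exact hh q hq
      · rw [getElem?_restrict (by have := (level_spec e (Nat.log 2 y)).1; omega),
          ne_eq, Option.some_inj]
        exact fun h => hne h.symm
  · intro h
    exact absurd (eq_false_of_mem_negativeDescription h) (by simp)
  · intro h hx
    obtain ⟨e, y, p, rfl, hp, rfl, hag⟩ := hC x hx
    obtain ⟨s, hs⟩ := mem_dom_negativeDescription.1 ((PFun.mem_dom _ _).2 ⟨_, h⟩)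
    rcases hs with ⟨q, -, hq, hne⟩ | ⟨t, ht, hnt, hw, i, hi, hne⟩
    · exact hne (by rw [hq.unique hp])
    · rw [hp.haltedBy_iff, not_le] at hw
      rw [length_restrict] at ht
      refine hne ?_
      rw [getElem?_restrict (by have := (level_spec e (Nat.log 2 p.unpair.2)).1; omega),
        hag t hnt hw.le i hi]

theorem computablePred_of_bounded {A : Set ℕ} {N : ℕ} (h : ∀ i ≥ N, i ∉ A) :
    ComputablePred fun n => n ∈ A := by
  classical
  have hp : PrimrecPred fun n : ℕ => ∃ m ∈ (List.range N).filter (· ∈ A), m = n :=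
    primrecPred_exists_mem (R := fun m (n : ℕ) => m = n) (Primrec.const _) Primrec.eq
  obtain ⟨_, hp⟩ := hp.of_eq fun n => show _ ↔ n ∈ A by
    simp only [List.mem_filter, List.mem_range, decide_eq_true_eq, exists_eq_right]
    exact ⟨fun h => h.2, fun hn => ⟨not_le.1 fun hle => h n hle hn, hn⟩⟩
  exact ⟨_, hp.to_comp⟩

/-- A nonrecursive set that is not recursive in any of the chosen paths agrees forever with the
approximate paths on only finitely many of the blocks that wait forever. -/
theorem finite_agreesUntil {c : OracleCode} {F : Set (List (Fin 4)) → ℕ → Fin 4}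
    (hpath : ∀ T, IsTree T → T.Infinite → IsPath (F T) T)
    (hc : ∀ T, IsTree T → T.Infinite →
      c.eval (chi (jump (treeOracle T))) = (pathFun (F T) : ℕ →. ℕ))
    {π : Fin 4 → ℕ} (hπ : π 0 = 0) {A : Set ℕ} (hA : ¬ ComputablePred fun n => n ∈ A)
    (hAF : ∀ T, IsInfiniteRecursiveTree T →
      ¬ (chi A : ℕ →. ℕ) ≤ᵀ (pathFun (F T) : ℕ →. ℕ)) (e : ℕ) :
    {n | (∀ p, ¬ HaltsAt e n p) ∧ ∀ p, AgreesUntil c π A e n p}.Finite := by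
  by_contra hinf
  -- the levels of these blocks are unbounded, so the approximate paths converge to `A`
  have hlim : ∀ i, ∀ᶠ s in Filter.atTop, π (stagePath c e s i) = chi A i := by
    intro i
    have hlev := Set.Infinite.image ((injOn_level e).mono fun n hn => hn.1) hinf
    obtain ⟨_, ⟨n, hn, rfl⟩, hlt⟩ := hlev.exists_gt i
    filter_upwards [Filter.eventually_ge_atTop n] with s hs
    exact hn.2 s s hs le_rfl i hlt
  by_cases hT : (columnTree c e).Infinite
  · have htree := isTree_columnTree c e
    refine hAF _ ⟨htree, hT, computablePred_columnTree c e⟩ ?_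
    have hlimF := eventually_stagePath (hc _ htree hT) (hpath _ htree hT)
    have heq : ∀ i, chi A i = π (F (columnTree c e) i) := by
      intro i
      obtain ⟨s, h1, h2⟩ := ((hlim i).and (hlimF i)).exists
      rw [← h1, h2]
    have hF : Computable₂ fun v _ : ℕ => π (Fin.ofNat 4 v) :=
      Primrec.to_comp ((Primrec.dom_finite π).comp (Primrec.fin_val_iff.1
        (Primrec.nat_mod.comp Primrec.fst (Primrec.const 4))))
    refine ((UniformlyRecursive.computable₂ hF .oracle (.of_computable
      Computable.id)).turingReducible _).of_eq fun i => ?_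
    simp [pathFun, heq]
  · obtain ⟨N, hN⟩ := stagePath_eq_zero (Set.not_infinite.1 hT)
    refine hA (computablePred_of_bounded (N := N) fun i hi hmem => ?_)
    obtain ⟨s, hs⟩ := (hlim i).exists
    rw [hN i hi s, hπ] at hs
    simp [chi, hmem] at hs

/-- The set that diagonalizes against all generic descriptions: an element of column `e` belongs
to it if it was the first of its block to receive an answer from program `e`, the answer was
negative, and until then the approximate paths agreed with `A` and `B`. -/
def diagonalSet (c : OracleCode) (A B : Set ℕ) : Set ℕ :=
  {x | ∃ e y p, column e y = x ∧ FirstHaltsAt e (Nat.log 2 y) p ∧ p.unpair.2 = y ∧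
    Code.evaln p.unpair.1 (Denumerable.ofNat Code e) x = some 0 ∧
    AgreesUntil c (fun a => (a : ℕ) / 2) A e (Nat.log 2 y) p ∧
    AgreesUntil c (fun a => (a : ℕ) % 2) B e (Nat.log 2 y) p}

/-- A generic description of the diagonal set would make the join of `A` and `B` a path through the
tree of its column, and then the chosen path could not be the limit of its approximations. -/
theorem not_genericallyComputable_diagonalSet {c : OracleCode}
    {F : Set (List (Fin 4)) → ℕ → Fin 4}
    (hpath : ∀ T, IsTree T → T.Infinite → IsPath (F T) T)
    (hc : ∀ T, IsTree T → T.Infinite →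
      c.eval (chi (jump (treeOracle T))) = (pathFun (F T) : ℕ →. ℕ)) (A B : Set ℕ) :
    ¬ GenericallyComputable (diagonalSet c A B) := by
  rintro ⟨φ, hφ, hdens, hcorr⟩
  obtain ⟨d, hd⟩ := Code.exists_code.1 hφ
  let e := encode d
  have hed : Denumerable.ofNat Code e = d := Denumerable.ofNat_encode d
  have hval (x v : ℕ) : v ∈ Code.eval d x ↔ ∃ b ∈ φ x, encode b = v := by
    rw [hd]
    simp
  obtain ⟨N, hN⟩ := hdens.exists_block e
  have hhalt : ∀ n ≥ N, ∃ p, HaltsAt e n p := by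
    intro n hn
    obtain ⟨y, hy, hdom⟩ := hN n hn
    obtain ⟨b, hb⟩ := (PFun.mem_dom _ _).1 hdom
    obtain ⟨k, hk⟩ := Code.evaln_complete.1 ((hval (column e y) (encode b)).2 ⟨b, hb, rfl⟩)
    refine ⟨Nat.pair k y, by simpa using hy, ?_⟩
    rw [Nat.unpair_pair, hed, Option.isSome_iff_exists]
    exact ⟨_, hk⟩
  -- the description would be wrong on a block on which the approximate paths agree with `A`, `B`
  have hdis : ∀ n p, FirstHaltsAt e n p → ¬ (AgreesUntil c (fun a => (a : ℕ) / 2) A e n p ∧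
      AgreesUntil c (fun a => (a : ℕ) % 2) B e n p) := by
    rintro n p hp ⟨hA, hB⟩
    obtain ⟨hlog, hsome⟩ := hp.1
    obtain ⟨v, hv⟩ := Option.isSome_iff_exists.1 hsome
    obtain ⟨b, hb, hbv⟩ := (hval _ v).1 (Code.evaln_sound (hed ▸ hv))
    subst hlog
    cases b with
    | false =>
      refine (hcorr _).2 hb ⟨e, _, p, rfl, hp, rfl, ?_, hA, hB⟩
      rw [hv, ← hbv]
      rfl
    | true =>
      obtain ⟨e', y', p', hcol, hp', hy', hv', -⟩ := (hcorr _).1 hb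
      obtain ⟨rfl, rfl⟩ := column_injective hcol
      rw [hp'.unique hp, hv, ← hbv] at hv'
      simp at hv'
  -- hence the join of `A` and `B` is a path through the tree
  let W : ℕ → Fin 4 := fun i => Fin.ofNat 4 (2 * chi A i + chi B i)
  have hW : ∀ i (a : Fin 4), W i = a → (a : ℕ) / 2 = chi A i ∧ (a : ℕ) % 2 = chi B i := by
    rintro i a rfl
    rcases chi_eq_zero_or_one A i with h | h <;> rcases chi_eq_zero_or_one B i with h' | h' <;>
      simp [W, h, h']
  have hWpath : IsPath W (columnTree c e) := by
    intro ℓ n hn p hp hh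
    simp only [List.length_map, List.length_range] at hn hp
    obtain ⟨q, hq, hhq⟩ := hh
    obtain ⟨q', hq', hfirst⟩ := hhq.exists_first
    by_contra! hno
    have hag : ∀ s, n ≤ s → s ≤ q' → ∀ i < level e n, W i = stagePath c e s i := by
      intro s hs hsq i hi
      have := hno s (by omega) hs i hi
      have hil : i < ℓ := by have := (level_spec e n).1; omega
      simpa [hil] using this
    exact hdis n q' hfirst ⟨fun s hs hsq i hi => (hW i _ (hag s hs hsq i hi)).1,
      fun s hs hsq i hi => (hW i _ (hag s hs hsq i hi)).2⟩
  have hT : (columnTree c e).Infinite := by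
    refine Set.infinite_of_injective_forall_mem (f := fun n => (List.range n).map W) ?_ hWpath
    intro m n h
    simpa using congrArg List.length h
  have htree := isTree_columnTree c e
  -- the chosen path differs from the approximate paths on the late blocks of a recurring level
  obtain ⟨k, hk⟩ := exists_infinite_level hhalt
  have hlim : ∀ᶠ s in Filter.atTop, ∀ i ∈ Finset.range k,
      stagePath c e s i = F (columnTree c e) i :=
    (Filter.eventually_all_finset _).2 fun i _ =>
      eventually_stagePath (hc _ htree hT) (hpath _ htree hT) i
  obtain ⟨M, hM⟩ := Filter.eventually_atTop.1 hlim
  obtain ⟨n, hn, hlt⟩ := hk.exists_gt (max M N)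
  obtain ⟨p, hp⟩ := hhalt n (by omega)
  have hnp := hp.lt
  obtain ⟨s, hs, hns, i, hi, hne⟩ := hpath _ htree hT (p + 1) n (by simp; omega) p (by simp)
    ⟨p, by omega, hp⟩
  refine hne ?_
  rw [hM s (by omega) i (by rw [Finset.mem_range]; exact hn ▸ hi)]
  have : i < p + 1 := by have := (level_spec e n).1; omega
  simp [this]

theorem not_isMinimalPair_of_isUniformPathChoice {F : Set (List (Fin 4)) → ℕ → Fin 4}
    (hF : IsUniformPathChoice F) {A B : Set ℕ}
    (hA : ∀ T, IsInfiniteRecursiveTree T →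
      ¬ (chi A : ℕ →. ℕ) ≤ᵀ (pathFun (F T) : ℕ →. ℕ))
    (hB : ∀ T, IsInfiniteRecursiveTree T →
      ¬ (chi B : ℕ →. ℕ) ≤ᵀ (pathFun (F T) : ℕ →. ℕ)) : ¬ IsMinimalPair A B := by
  obtain ⟨hpath, c, hc⟩ := hF
  rintro ⟨hA', hB', hmin⟩
  refine not_genericallyComputable_diagonalSet hpath hc A B (hmin _ ?_ ?_)
  · refine genericallyComputableIn_of_agreesUntil (π := fun a => (a : ℕ) / 2) ?_
      (finite_agreesUntil hpath hc rfl hA' hA)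
    rintro x ⟨e, y, p, h1, h2, h3, -, h4, -⟩
    exact ⟨e, y, p, h1, h2, h3, h4⟩
  · refine genericallyComputableIn_of_agreesUntil (π := fun a => (a : ℕ) % 2) ?_
      (finite_agreesUntil hpath hc rfl hB' hB)
    rintro x ⟨e, y, p, h1, h2, h3, -, -, h4⟩
    exact ⟨e, y, p, h1, h2, h3, h4⟩

end GenericPairs

theorem mainTheorem4 :
    (∀ F : Set (List (Fin 4)) → ℕ → Fin 4, GenericPairs.IsUniformPathChoice F →
      ∀ A B : Set ℕ,
        ¬ GenericPairs.IsMinimalPair A B ∨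
        (∃ T, GenericPairs.IsInfiniteRecursiveTree T ∧
          (GenericPairs.chi A : ℕ →. ℕ) ≤ᵀ (GenericPairs.pathFun (F T) : ℕ →. ℕ)) ∨
        (∃ T, GenericPairs.IsInfiniteRecursiveTree T ∧
          (GenericPairs.chi B : ℕ →. ℕ) ≤ᵀ (GenericPairs.pathFun (F T) : ℕ →. ℕ))) ∧
    (∃ F : Set (List (Fin 4)) → ℕ → Fin 4, GenericPairs.IsUniformPathChoice F ∧
      ∀ T, GenericPairs.IsInfiniteRecursiveTree T →
        GenericPairs.IsLow (GenericPairs.pathFun (F T))) ∧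
    (∀ A B : Set ℕ, GenericPairs.IsMinimalPair A B →
      GenericPairs.IsLow (GenericPairs.chi A) ∨ GenericPairs.IsLow (GenericPairs.chi B)) := by
  have hmain : ∀ F : Set (List (Fin 4)) → ℕ → Fin 4, GenericPairs.IsUniformPathChoice F →
      ∀ A B : Set ℕ,
        ¬ GenericPairs.IsMinimalPair A B ∨
        (∃ T, GenericPairs.IsInfiniteRecursiveTree T ∧
          (GenericPairs.chi A : ℕ →. ℕ) ≤ᵀ (GenericPairs.pathFun (F T) : ℕ →. ℕ)) ∨
        (∃ T, GenericPairs.IsInfiniteRecursiveTree T ∧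
          (GenericPairs.chi B : ℕ →. ℕ) ≤ᵀ (GenericPairs.pathFun (F T) : ℕ →. ℕ)) := by
    intro F hF A B
    by_contra! h
    exact GenericPairs.not_isMinimalPair_of_isUniformPathChoice hF h.2.1 h.2.2 h.1
  have hchoice := GenericPairs.isUniformPathChoice_lowPath
  refine ⟨hmain, ⟨_, hchoice, fun T hT => GenericPairs.isLow_lowPath hT⟩, fun A B hAB => ?_⟩
  rcases hmain _ hchoice A B with h | ⟨T, hT, h⟩ | ⟨T, hT, h⟩
  · exact absurd hAB h
  · exact Or.inl ((GenericPairs.isLow_lowPath hT).of_turingReducible h)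
  · exact Or.inr ((GenericPairs.isLow_lowPath hT).of_turingReducible h)
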